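/- Consider the capacitated $k$-facility location problem with uniform hard capacities: given a set $D$ of $m$ clients with demands $d_j \ge 0$, a set $F$ of $n$ facilities, each of capacity $s > 0$, opening costs $f_i \ge 0$, unit service costs $c_{ij} \ge 0$ ($i\in F$, $j\in D$) and an integer $k \ge 0$, minimize $$\sum_{i\in F}\sum_{j\in D} c_{ij}x_{ij}+\sum_{i\in F} f_i y_i$$ subject to $\sum_{i\in F} x_{ij}=d_j$ for all $j\in D$, $\sum_{j\in D}x_{ij}\le s\,y_i$ for all $i\in F$, $\sum_{i\in F}y_i\le k$, $x_{ij}\ge 0$ and $y_i\in\{0,1\}$. For every fixed number $m$ of clients, this problem can be solved exactly in time $O\big(\binom{n}{m}\cdot n^3\big)$. Precisely: for every $m \ge 0$ there are a program $P$ for a random access machine with real arithmetic and a constant $K$ such that, for every $n \ge 0$ and every instance with $m$ clients, $n$ facilities and real data as above, $P$ halts after at most $K\big(\binom{n}{m}n^3+1\big)$ elementary operations, and outputs an optimal solution $(x,y)$ if the instance is feasible and reports infeasibility otherwise. The elementary operations, each taking one unit of time, are: assignments, branchings, logical connectives, and access to constants and to memory and input cells; addition, truncated subtraction and comparison of natural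 numbers (used as indices, counters and flags); addition, subtraction and comparison of real numbers, and multiplication of a real number by an input number. The only real constants are $0$ and $1$; there is no division and no rounding. -/

import Mathlib

namespace CKFL

/-! ### The problem -/

/-- An instance of the capacitated `k`-facility location problem with uniform capacities, with
client set `D = Fin m` and facility set `F = Fin n`: at most `k` facilities may be opened, each
facility has capacity `s`, client `j` has demand `d j`, opening facility `i` costs `f i`, and
shipping one unit from facility `i` to client `j` costs `c i j`. -/
structure UniformInstance (m n : ℕ) where
  k : ℕ
  s : ℝ
  d : Fin m → ℝ
  f : Fin n → ℝ
  c : Fin n → Fin m → ℝ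
  s_pos : 0 < s
  d_nonneg : ∀ j, 0 ≤ d j
  f_nonneg : ∀ i, 0 ≤ f i
  c_nonneg : ∀ i j, 0 ≤ c i j

namespace UniformInstance

variable {m n : ℕ}

/-- The constraints of the mixed integer program: `x i j` is the amount shipped from facility `i`
to client `j`, and `y i = 1` if facility `i` is open, `y i = 0` otherwise. -/
structure IsFeasible (I : UniformInstance m n) (x : Fin n → Fin m → ℝ) (y : Fin n → ℕ) :
    Prop where
  demand : ∀ j, ∑ i, x i j = I.d j
  capacity : ∀ i, ∑ j, x i j ≤ I.s * (y i : ℝ)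
  cardinality : ∑ i, y i ≤ I.k
  nonneg : ∀ i j, 0 ≤ x i j
  binary : ∀ i, y i = 0 ∨ y i = 1

/-- The objective: total service cost plus total opening cost. -/
def totalCost (I : UniformInstance m n) (x : Fin n → Fin m → ℝ) (y : Fin n → ℕ) : ℝ :=
  ∑ i, ∑ j, I.c i j * x i j + ∑ i, I.f i * (y i : ℝ)

/-- `(x, y)` is an exact optimal solution. -/
def IsOptimal (I : UniformInstance m n) (x : Fin n → Fin m → ℝ) (y : Fin n → ℕ) : Prop :=
  I.IsFeasible x y ∧ ∀ x' y', I.IsFeasible x' y' → I.totalCost x y ≤ I.totalCost x' y'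

end UniformInstance

/-! ### The machine model

A random access machine with real arithmetic, presented as a structured programming language.
The memory consists of arrays of natural numbers (for indices, counters and flags) and arrays of
real numbers; arrays are named by natural numbers and have two indices. A scalar variable is an
array that is used at one place only. The numerical data of the instance sit in read-only input
arrays. Every elementary operation (reading a constant, a memory cell or an input cell, an
arithmetic operation, a comparison, a logical connective, an assignment, a branching) takes one
unit of time.

The only operations on natural numbers are addition and truncated subtraction. The only operations
on reals are addition, subtraction and the multiplication of a number by an input number;
there is no division, no rounding, and there are no real constants except `0` and `1`. So on
integer inputs the bit length of the largest stored number grows, with each operation, at most by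
an additive term of the order of the input length, and unit costs do not hide computations with
numbers of exponential length. -/

/-- The names of the four input arrays: service costs, opening costs, demands, capacity. -/
inductive InputArray where
  | service
  | opening
  | demand
  | capacity

/-- The contents of the read-only input arrays. -/
abbrev Input := InputArray → ℕ → ℕ → ℝ

/-- The contents of the memory: `nat a p q` and `real a p q` are the entries at `(p, q)` of the
`a`-th array of natural numbers and of the `a`-th array of real numbers. -/
structure Store where
  nat : ℕ → ℕ → ℕ → ℕ
  real : ℕ → ℕ → ℕ → ℝ

namespace Store

/-- The memory after the assignment `nat a p q := v`. -/
def setNat (σ : Store) (a p q v : ℕ) : Store where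
  nat := fun a' p' q' => if a' = a ∧ p' = p ∧ q' = q then v else σ.nat a' p' q'
  real := σ.real

/-- The memory after the assignment `real a p q := v`. -/
noncomputable def setReal (σ : Store) (a p q : ℕ) (v : ℝ) : Store where
  nat := σ.nat
  real := fun a' p' q' => if a' = a ∧ p' = p ∧ q' = q then v else σ.real a' p' q'

end Store

/-- Expressions with natural number values. -/
inductive NExp where
  | const (v : ℕ)
  | get (a : ℕ) (p q : NExp)
  | add (e₁ e₂ : NExp)
  | sub (e₁ e₂ : NExp)

namespace NExp

/-- The value of an expression; `sub` is truncated subtraction. -/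
def eval (σ : Store) : NExp → ℕ
  | const v => v
  | get a p q => σ.nat a (p.eval σ) (q.eval σ)
  | add e₁ e₂ => e₁.eval σ + e₂.eval σ
  | sub e₁ e₂ => e₁.eval σ - e₂.eval σ

/-- The time for the evaluation: the number of operations. -/
def time : NExp → ℕ
  | const _ => 1
  | get _ p q => p.time + q.time + 1
  | add e₁ e₂ => e₁.time + e₂.time + 1
  | sub e₁ e₂ => e₁.time + e₂.time + 1

end NExp

/-- Expressions with real values. -/
inductive RExp where
  | zero
  | one
  | get (a : ℕ) (p q : NExp)
  | input (u : InputArray) (p q : NExp)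
  | add (e₁ e₂ : RExp)
  | sub (e₁ e₂ : RExp)
  | mulInput (u : InputArray) (p q : NExp) (e : RExp)

namespace RExp

/-- The value of an expression; `mulInput u p q e` is the input number at place `(p, q)` of the
array `u` times the value of `e`. -/
noncomputable def eval (inp : Input) (σ : Store) : RExp → ℝ
  | zero => 0
  | one => 1
  | get a p q => σ.real a (p.eval σ) (q.eval σ)
  | input u p q => inp u (p.eval σ) (q.eval σ)
  | add e₁ e₂ => e₁.eval inp σ + e₂.eval inp σ
  | sub e₁ e₂ => e₁.eval inp σ - e₂.eval inp σ
  | mulInput u p q e => inp u (p.eval σ) (q.eval σ) * e.eval inp σ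

/-- The time for the evaluation: the number of operations. -/
def time : RExp → ℕ
  | zero => 1
  | one => 1
  | get _ p q => p.time + q.time + 1
  | input _ p q => p.time + q.time + 1
  | add e₁ e₂ => e₁.time + e₂.time + 1
  | sub e₁ e₂ => e₁.time + e₂.time + 1
  | mulInput _ p q e => p.time + q.time + e.time + 2

end RExp

/-- Tests. -/
inductive Test where
  | natLE (e₁ e₂ : NExp)
  | realLE (e₁ e₂ : RExp)
  | neg (b : Test)
  | both (b₁ b₂ : Test)

namespace Test

/-- The truth of a test. -/
def Holds (inp : Input) (σ : Store) : Test → Prop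
  | natLE e₁ e₂ => e₁.eval σ ≤ e₂.eval σ
  | realLE e₁ e₂ => e₁.eval inp σ ≤ e₂.eval inp σ
  | neg b => ¬ b.Holds inp σ
  | both b₁ b₂ => b₁.Holds inp σ ∧ b₂.Holds inp σ

/-- The time for the evaluation: the number of operations. -/
def time : Test → ℕ
  | natLE e₁ e₂ => e₁.time + e₂.time + 1
  | realLE e₁ e₂ => e₁.time + e₂.time + 1
  | neg b => b.time + 1
  | both b₁ b₂ => b₁.time + b₂.time + 1

end Test

/-- Programs: the empty program, the assignments `nat a p q := e` and `real a p q := e`,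
composition, `if b then P else Q`, and `while b do P`. -/
inductive Program where
  | skip
  | assignNat (a : ℕ) (p q : NExp) (e : NExp)
  | assignReal (a : ℕ) (p q : NExp) (e : RExp)
  | seq (P Q : Program)
  | cond (b : Test) (P Q : Program)
  | loop (b : Test) (P : Program)

/-- `Exec inp P σ t τ`: on the input `inp`, the program `P` started with memory `σ` halts after
exactly `t` units of time with memory `τ`. -/
inductive Exec (inp : Input) : Program → Store → ℕ → Store → Prop where
  | skip (σ : Store) : Exec inp .skip σ 1 σ
  | assignNat (σ : Store) (a : ℕ) (p q e : NExp) :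
      Exec inp (.assignNat a p q e) σ (p.time + q.time + e.time + 1)
        (σ.setNat a (p.eval σ) (q.eval σ) (e.eval σ))
  | assignReal (σ : Store) (a : ℕ) (p q : NExp) (e : RExp) :
      Exec inp (.assignReal a p q e) σ (p.time + q.time + e.time + 1)
        (σ.setReal a (p.eval σ) (q.eval σ) (e.eval inp σ))
  | seq {P Q : Program} {σ τ ρ : Store} {t u : ℕ} :
      Exec inp P σ t τ → Exec inp Q τ u ρ → Exec inp (.seq P Q) σ (t + u) ρ
  | condTrue {b : Test} {P Q : Program} {σ τ : Store} {t : ℕ} :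
      b.Holds inp σ → Exec inp P σ t τ → Exec inp (.cond b P Q) σ (b.time + 1 + t) τ
  | condFalse {b : Test} {P Q : Program} {σ τ : Store} {t : ℕ} :
      ¬ b.Holds inp σ → Exec inp Q σ t τ → Exec inp (.cond b P Q) σ (b.time + 1 + t) τ
  | loopStop {b : Test} {P : Program} {σ : Store} :
      ¬ b.Holds inp σ → Exec inp (.loop b P) σ (b.time + 1) σ
  | loopStep {b : Test} {P : Program} {σ τ ρ : Store} {t u : ℕ} :
      b.Holds inp σ → Exec inp P σ t τ → Exec inp (.loop b P) τ u ρ →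
      Exec inp (.loop b P) σ (b.time + 1 + t + u) ρ

/-! ### Solving an instance -/

namespace UniformInstance

variable {m n : ℕ}

/-- The input arrays of an instance (zero outside the index ranges). -/
noncomputable def input (I : UniformInstance m n) : Input
  | .service, p, q => if h : p < n ∧ q < m then I.c ⟨p, h.1⟩ ⟨q, h.2⟩ else 0
  | .opening, p, _ => if h : p < n then I.f ⟨p, h⟩ else 0
  | .demand, p, _ => if h : p < m then I.d ⟨p, h⟩ else 0
  | .capacity, _, _ => I.s

/-- The initial memory: `n` and `k` stand in the array `nat 0` at the places `(0, 0)` and `(0, 1)`;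
everything else is zero. -/
noncomputable def initial (I : UniformInstance m n) : Store where
  nat := fun a p q =>
    if a = 0 ∧ p = 0 ∧ q = 0 then n else if a = 0 ∧ p = 0 ∧ q = 1 then I.k else 0
  real := fun _ _ _ => 0

/-- The program `P` solves the instance `I` exactly in `t` units of time. If `I` is feasible, then
`P` writes the flag `1` into `nat 1 0 0` and an optimal solution `(x, y)` into the arrays `real 0`
(with `x i j` at `(i, j)`) and `nat 2` (with `y i` at `(i, 0)`); if `I` is infeasible, then `P`
leaves the flag `0` in `nat 1 0 0`. -/
def SolvedBy (I : UniformInstance m n) (P : Program) (t : ℕ) : Prop :=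
  ∃ τ : Store, Exec I.input P I.initial t τ ∧
    ((∃ x y, I.IsFeasible x y) →
      τ.nat 1 0 0 = 1 ∧ I.IsOptimal (fun i j => τ.real 0 i j) (fun i => τ.nat 2 i 0)) ∧
    ((¬ ∃ x y, I.IsFeasible x y) → τ.nat 1 0 0 = 0)

end UniformInstance

end CKFL

/-! For a fixed set of open facilities the problem is a transportation problem. A slack column turns
the capacity constraints into row sums `s * y i`, which leaves `m + 1` columns. Pushing flow along
circulations without raising the cost ends at a solution whose support carries no circulation
(`exists_noCirculation`), that is, a forest in the bipartite graph of rows and columns. Two facts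
about forests carry the proof. At most `m` rows have two nonzero entries (`NoCirculation.card_le`);
every other open row ships its whole capacity to one column. Deleting a support entry cuts the
columns in two (`NoCirculation.exists_cut`). On the side without the slack column the clients'
demands add up to a multiple of `s` plus either the entry or `s` minus the entry. So every entry is,
up to reflection in `s`, the residue modulo `s` of a subset sum of the demands
(`exists_structured`). Residues need no division: `n` conditional subtractions suffice.

Hence the rows of the at most `m` special facilities are described by a `Pattern m`, and the number
of patterns depends on `m` only. With a pattern fixed, each facility gets one of `2 * m + 1` types:
closed, full towards one client, or a given special row. Feasibility depends only on which special
rows occur and on the multiplicities of the full types (`Chain.sum_congr`,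
`ChainFeasible.transfer`). If the special rows are used in the order of their numbers, their count
`h` is all that must be remembered; the multiplicities are the digits of one number `Q < (n + 1) ^
m`. Dynamic programming over the facilities finds a cheapest type sequence for each `(h, Q)`. It is
enough to test this one sequence for feasibility, because all sequences with the same `(h, Q)` are
feasible together (`candidate_spec`).

The tables have about `(n + 1) ^ (m + 1)` entries, up to a factor depending on `m`, and reading off
and testing one candidate takes linear time for each `(h, Q)`. The total is of order `(n + 1) ^ (m +
1)`. This is of order `n.choose m * n` if `n ≥ m ≥ 1`, and bounded in terms of `m` if `n < m`
(`succ_pow_succ_le`).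

Running times are tracked in the form "weight of the program text times `X`". The weight depends on
`m` only, so `X` records just the dependence on loop lengths. -/

namespace CKFL

/-! ### A program logic with time bounds -/

namespace Program

/-- A bound for the time of one pass through the text of a program. -/
def weight : Program → ℕ
  | skip => 1
  | assignNat _ p q e => p.time + q.time + e.time + 1
  | assignReal _ p q e => p.time + q.time + e.time + 1
  | seq P Q => P.weight + Q.weight
  | cond b P Q => b.time + 1 + P.weight + Q.weight
  | loop b P => b.time + 1 + P.weight

/-- Whether the text of a program has an assignment to the given array of natural numbers. -/
def writesNat (a : ℕ) : Program → Bool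
  | skip => false
  | assignNat a' _ _ _ => a' == a
  | assignReal _ _ _ _ => false
  | seq P Q => P.writesNat a || Q.writesNat a
  | cond _ P Q => P.writesNat a || Q.writesNat a
  | loop _ P => P.writesNat a

/-- Whether the text of a program has an assignment to the given array of real numbers. -/
def writesReal (a : ℕ) : Program → Bool
  | skip => false
  | assignNat _ _ _ _ => false
  | assignReal a' _ _ _ => a' == a
  | seq P Q => P.writesReal a || Q.writesReal a
  | cond _ P Q => P.writesReal a || Q.writesReal a
  | loop _ P => P.writesReal a

end Program

/-- The memories `σ` and `τ` agree on all arrays that `P` does not write. -/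
structure Frame (P : Program) (σ τ : Store) : Prop where
  nat : ∀ a, P.writesNat a = false → τ.nat a = σ.nat a
  real : ∀ a, P.writesReal a = false → τ.real a = σ.real a

theorem Frame.refl (P : Program) (σ : Store) : Frame P σ σ := ⟨fun _ _ => rfl, fun _ _ => rfl⟩

theorem Frame.trans {P : Program} {σ τ ρ : Store} (h : Frame P σ τ) (h' : Frame P τ ρ) :
    Frame P σ ρ :=
  ⟨fun a ha => (h'.nat a ha).trans (h.nat a ha), fun a ha => (h'.real a ha).trans (h.real a ha)⟩

theorem Frame.mono {P Q : Program} {σ τ : Store} (h : Frame P σ τ)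
    (hN : ∀ a, Q.writesNat a = false → P.writesNat a = false)
    (hR : ∀ a, Q.writesReal a = false → P.writesReal a = false) : Frame Q σ τ :=
  ⟨fun a ha => h.nat a (hN a ha), fun a ha => h.real a (hR a ha)⟩

/-- The frame is a syntactic condition on the program text. For concrete programs and array names it
is therefore decided by computation, and the later proofs discharge it by `rfl`. -/
theorem Exec.frame {inp : Input} {P : Program} {σ τ : Store} {t : ℕ} (h : Exec inp P σ t τ) :
    Frame P σ τ := by
  induction h with
  | skip σ => exact Frame.refl _ _
  | assignNat σ a p q e =>
    refine ⟨fun a' ha => ?_, fun _ _ => rfl⟩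
    have : a' ≠ a := fun h => by simp [Program.writesNat, h] at ha
    funext p' q'
    simp [Store.setNat, this]
  | assignReal σ a p q e =>
    refine ⟨fun _ _ => rfl, fun a' ha => ?_⟩
    have : a' ≠ a := fun h => by simp [Program.writesReal, h] at ha
    funext p' q'
    simp [Store.setReal, this]
  | seq _ _ ih₁ ih₂ =>
    refine Frame.trans (ih₁.mono ?_ ?_) (ih₂.mono ?_ ?_) <;>
      simp +contextual [Program.writesNat, Program.writesReal]
  | condTrue _ _ ih => 
    refine ih.mono ?_ ?_ <;> simp +contextual [Program.writesNat, Program.writesReal]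
  | condFalse _ _ ih =>
    refine ih.mono ?_ ?_ <;> simp +contextual [Program.writesNat, Program.writesReal]
  | loopStop _ => exact Frame.refl _ _
  | loopStep _ _ _ ih₁ ih₂ =>
    refine Frame.trans (ih₁.mono ?_ ?_) ih₂ <;>
      simp +contextual [Program.writesNat, Program.writesReal]

/-- The program `P`, started with memory `σ`, halts within `X` times its weight, and the final
memory satisfies `Φ`. -/
def Runs (inp : Input) (P : Program) (σ : Store) (X : ℕ) (Φ : Store → Prop) : Prop :=
  ∃ t τ, Exec inp P σ t τ ∧ t ≤ P.weight * X ∧ Φ τ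

namespace Runs

variable {inp : Input} {P Q : Program} {σ : Store} {X Y : ℕ} {Φ Ψ : Store → Prop}

theorem imp (h : Runs inp P σ X Φ) (hΨ : ∀ τ, Frame P σ τ → Φ τ → Ψ τ) : Runs inp P σ X Ψ := by
  obtain ⟨t, τ, hE, ht, hΦ⟩ := h
  exact ⟨t, τ, hE, ht, hΨ τ hE.frame hΦ⟩

theorem mono (h : Runs inp P σ X Φ) (hXY : X ≤ Y) : Runs inp P σ Y Φ := by
  obtain ⟨t, τ, hE, ht, hΦ⟩ := h
  exact ⟨t, τ, hE, ht.trans (Nat.mul_le_mul_left _ hXY), hΦ⟩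

theorem skip (hX : 1 ≤ X) (h : Φ σ) : Runs inp .skip σ X Φ :=
  ⟨1, σ, .skip σ, by simpa [Program.weight] using hX, h⟩

theorem assignNat {a : ℕ} {p q e : NExp} (hX : 1 ≤ X)
    (h : Φ (σ.setNat a (p.eval σ) (q.eval σ) (e.eval σ))) :
    Runs inp (.assignNat a p q e) σ X Φ :=
  ⟨_, _, .assignNat σ a p q e, Nat.le_mul_of_pos_right _ hX, h⟩

theorem assignReal {a : ℕ} {p q : NExp} {e : RExp} (hX : 1 ≤ X)
    (h : Φ (σ.setReal a (p.eval σ) (q.eval σ) (e.eval inp σ))) :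
    Runs inp (.assignReal a p q e) σ X Φ :=
  ⟨_, _, .assignReal σ a p q e, Nat.le_mul_of_pos_right _ hX, h⟩

/-- Weights add under composition, so the same factor `X` serves both parts and the whole; constants
never accumulate in `X`. -/
theorem seq (h : Runs inp P σ X Φ) (h' : ∀ τ, Frame P σ τ → Φ τ → Runs inp Q τ X Ψ) :
    Runs inp (.seq P Q) σ X Ψ := by
  obtain ⟨t, τ, hE, ht, hΦ⟩ := h
  obtain ⟨u, ρ, hE', hu, hΨ⟩ := h' τ hE.frame hΦ
  refine ⟨_, _, .seq hE hE', ?_, hΨ⟩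
  simp only [Program.weight]
  nlinarith

/-- Composition, with the rest of the program as the postcondition. -/
theorem comp (h : Runs inp P σ X (fun τ => Runs inp Q τ X Ψ)) : Runs inp (.seq P Q) σ X Ψ :=
  h.seq fun _ _ h' => h'

theorem cond {b : Test} (hX : 1 ≤ X) (h : b.Holds inp σ → Runs inp P σ X Φ)
    (h' : ¬ b.Holds inp σ → Runs inp Q σ X Φ) : Runs inp (.cond b P Q) σ X Φ := by
  have hb : b.time + 1 ≤ (b.time + 1) * X := Nat.le_mul_of_pos_right _ hX
  by_cases hh : b.Holds inp σ
  · obtain ⟨t, τ, hE, ht, hΦ⟩ := h hh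
    refine ⟨_, _, .condTrue hh hE, ?_, hΦ⟩
    simp only [Program.weight]
    nlinarith [Nat.zero_le (Q.weight * X)]
  · obtain ⟨t, τ, hE, ht, hΦ⟩ := h' hh
    refine ⟨_, _, .condFalse hh hE, ?_, hΦ⟩
    simp only [Program.weight]
    nlinarith [Nat.zero_le (P.weight * X)]

end Runs

/-! ### Scalars, counting loops and unrolled loops -/

namespace NExp

/-- The scalar variable that occupies the `a`-th array. -/
def var (a : ℕ) : NExp := .get a (.const 0) (.const 0)

@[simp] theorem eval_var (σ : Store) (a : ℕ) : (var a).eval σ = σ.nat a 0 0 := rfl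

/-- The multiple of an expression by a constant. -/
def mulConst (c : ℕ) (e : NExp) : NExp :=
  match c with
  | 0 => .const 0
  | c + 1 => .add (mulConst c e) e

@[simp] theorem eval_mulConst (σ : Store) (c : ℕ) (e : NExp) :
    (mulConst c e).eval σ = c * e.eval σ := by
  induction c with
  | zero => simp [mulConst, eval]
  | succ c ih => simp [mulConst, eval, ih, Nat.succ_mul]

end NExp

namespace RExp

/-- The scalar variable that occupies the `a`-th array. -/
def var (a : ℕ) : RExp := .get a (.const 0) (.const 0)

@[simp] theorem eval_var (inp : Input) (σ : Store) (a : ℕ) :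
    (var a).eval inp σ = σ.real a 0 0 := rfl

end RExp

namespace Program

/-- `c := e` for a scalar variable `c`. -/
def setVar (c : ℕ) (e : NExp) : Program := .assignNat c (.const 0) (.const 0) e

/-- `c := e` for a real scalar variable `c`. -/
def setRealVar (c : ℕ) (e : RExp) : Program := .assignReal c (.const 0) (.const 0) e

/-- `for c := 0, …, b - 1 do P`. -/
def forLoop (c : ℕ) (b : NExp) (P : Program) : Program :=
  .seq (setVar c (.const 0))
    (.loop (.natLE (.add (.var c) (.const 1)) b)
      (.seq P (setVar c (.add (.var c) (.const 1)))))

/-- The composition of a list of programs. -/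
def seqList : List Program → Program
  | [] => .skip
  | P :: L => .seq P (seqList L)

theorem writesNat_seqList {a : ℕ} {L : List Program} (h : ∀ P ∈ L, P.writesNat a = false) :
    (seqList L).writesNat a = false := by
  induction L with
  | nil => rfl
  | cons P L ih =>
    simp only [seqList, writesNat, h P (by simp), Bool.false_or]
    exact ih fun Q hQ => h Q (by simp [hQ])

theorem writesReal_seqList {a : ℕ} {L : List Program} (h : ∀ P ∈ L, P.writesReal a = false) :
    (seqList L).writesReal a = false := by
  induction L with
  | nil => rfl
  | cons P L ih =>
    simp only [seqList, writesReal, h P (by simp), Bool.false_or]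
    exact ih fun Q hQ => h Q (by simp [hQ])

end Program

namespace Runs

variable {inp : Input} {P : Program} {σ : Store} {X : ℕ} {Φ : Store → Prop}

theorem setVar {c : ℕ} {e : NExp} (hX : 1 ≤ X) (h : Φ (σ.setNat c 0 0 (e.eval σ))) :
    Runs inp (.setVar c e) σ X Φ :=
  assignNat hX h

theorem setRealVar {c : ℕ} {e : RExp} (hX : 1 ≤ X) (h : Φ (σ.setReal c 0 0 (e.eval inp σ))) :
    Runs inp (.setRealVar c e) σ X Φ :=
  assignReal hX h

/-- The body must not write the counter, the bound must keep its value along the loop, and the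
invariant must survive changes of the counter cell. The factor is `N + 1` and not `N` because the
initialization and the last, failing test are also paid for. -/
theorem forLoop {c : ℕ} {b : NExp} {N : ℕ} (Inv : ℕ → Store → Prop) (hX : 1 ≤ X)
    (hc : P.writesNat c = false)
    (hb : ∀ τ, Frame (.forLoop c b P) σ τ → b.eval τ = N)
    (hst : ∀ i τ v, Inv i τ → Inv i (τ.setNat c 0 0 v))
    (h0 : Inv 0 σ)
    (hs : ∀ i < N, ∀ τ, Frame (.forLoop c b P) σ τ → τ.nat c 0 0 = i → Inv i τ →
      Runs inp P τ X (Inv (i + 1))) :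
    Runs inp (.forLoop c b P) σ (X * (N + 1)) (Inv N) := by
  set L : Program := .loop (.natLE (.add (.var c) (.const 1)) b)
    (.seq P (.setVar c (.add (.var c) (.const 1)))) with hL
  set b' : Test := .natLE (.add (.var c) (.const 1)) b with hb'
  have hLF : ∀ {τ ρ : Store}, Frame L τ ρ → Frame (.forLoop c b P) τ ρ := fun h => by
    refine h.mono (fun a ha => ?_) (fun a ha => ?_)
    · simp only [Program.forLoop, Program.writesNat, Bool.or_eq_false_iff] at ha
      simpa [hL, Program.writesNat] using ha.2
    · simp only [Program.forLoop, Program.writesReal, Bool.or_eq_false_iff] at ha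
      simpa [hL, Program.writesReal] using ha.2
  -- Induction on the number `k` of remaining passes; `8` is the time for incrementing the counter.
  have key : ∀ k i, i + k = N → ∀ τ, Frame (.forLoop c b P) σ τ → τ.nat c 0 0 = i → Inv i τ →
      ∃ t ρ, Exec inp L τ t ρ ∧
        t ≤ (k + 1) * (b'.time + 1) + k * (P.weight * X + 8) ∧ Inv N ρ := by
    intro k
    induction k with
    | zero =>
      intro i hi τ hF hτ hI
      have hi' : i = N := by omega
      refine ⟨_, τ, .loopStop ?_, by simp [hb'], hi' ▸ hI⟩
      simp only [Test.Holds, NExp.eval, NExp.eval_var, hτ, hb τ hF]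
      omega
    | succ k ih =>
      intro i hi τ hF hτ hI
      obtain ⟨t, ρ, hE, ht, hρ⟩ := hs i (by omega) τ hF hτ hI
      have hρc : ρ.nat c 0 0 = i := by rw [hE.frame.nat c hc, hτ]
      have hE2 : Exec inp (.seq P (.setVar c (.add (.var c) (.const 1)))) τ (t + 8)
          (ρ.setNat c 0 0 (i + 1)) := by
        have := Exec.seq hE (Exec.assignNat (inp := inp) ρ c (.const 0) (.const 0)
          (.add (.var c) (.const 1)))
        simpa [NExp.eval, hρc, NExp.time, NExp.var, Program.setVar] using this
      have hF2 : Frame (.forLoop c b P) σ (ρ.setNat c 0 0 (i + 1)) := by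
        refine hF.trans (hE2.frame.mono (fun a ha => ?_) (fun a ha => ?_))
        · simp only [Program.forLoop, Program.writesNat, Bool.or_eq_false_iff] at ha
          simpa [Program.writesNat] using ha.2
        · simp only [Program.forLoop, Program.writesReal, Bool.or_eq_false_iff] at ha
          simpa [Program.writesReal] using ha.2
      obtain ⟨u, ρ', hE', hu, hI'⟩ := ih (i + 1) (by omega) _ hF2 (by simp [Store.setNat])
        (hst _ _ _ hρ)
      refine ⟨_, ρ', .loopStep ?_ hE2 hE', ?_, hI'⟩
      · simp only [Test.Holds, NExp.eval, NExp.eval_var, hτ, hb τ hF]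
        omega
      · change b'.time + 1 + (t + 8) + u ≤ _
        nlinarith
  have hF0 : Frame (.forLoop c b P) σ (σ.setNat c 0 0 0) := by
    have := (Exec.assignNat (inp := inp) σ c (.const 0) (.const 0) (.const 0)).frame
    refine this.mono (fun a ha => ?_) (fun a ha => rfl)
    simp only [Program.forLoop, Program.writesNat, Bool.or_eq_false_iff] at ha
    exact ha.1
  obtain ⟨t, ρ, hE, ht, hρ⟩ := key N 0 (by omega) _ hF0 (by simp [Store.setNat]) (hst _ _ _ h0)
  refine ⟨_, ρ, .seq (.assignNat σ c (.const 0) (.const 0) (.const 0)) hE, ?_, hρ⟩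
  simp only [Program.forLoop, Program.weight, Program.setVar, NExp.time, NExp.var]
  change _ ≤ (_ + (b'.time + 1 + _)) * _
  nlinarith [Nat.zero_le (N * X), Nat.mul_le_mul_left (N * (b'.time + 1)) hX,
    Nat.mul_le_mul_left (b'.time + 1) hX, Nat.mul_le_mul_left N hX,
    Nat.zero_le (P.weight * X)]

/-- The invariant is indexed by the set of processed elements, so the order of the list plays no
role. The length of the list is absorbed by the weight. -/
theorem seqList {α : Type*} (f : α → Program) (Inv : Set α → Store → Prop) (hX : 1 ≤ X)
    (L : List α)
    (hs : ∀ S : Set α, ∀ x ∈ L, ∀ τ, Frame (.seqList (L.map f)) σ τ → Inv S τ →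
      Runs inp (f x) τ X (Inv (insert x S)))
    (h0 : Inv ∅ σ) : Runs inp (.seqList (L.map f)) σ X (Inv {x | x ∈ L}) := by
  have key : ∀ (L' : List α) (S : Set α) (τ : Store), (∀ x ∈ L', x ∈ L) →
      Frame (.seqList (L.map f)) σ τ → Inv S τ →
      Runs inp (.seqList (L'.map f)) τ X (Inv (S ∪ {x | x ∈ L'})) := by
    intro L'
    induction L' with
    | nil => intro S τ _ _ hI; exact skip hX (by simpa using hI)
    | cons x L' ih =>
      intro S τ hL' hF hI
      refine (hs S x (hL' x (by simp)) τ hF hI).seq fun ρ hFρ hρ => ?_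
      have hFx : Frame (.seqList (L.map f)) τ ρ := by
        have hx : x ∈ L := hL' x (by simp)
        clear hs h0 ih hF hL'
        refine hFρ.mono (fun a ha => ?_) (fun a ha => ?_)
        · induction L with
          | nil => simp at hx
          | cons z L ihL =>
            simp only [List.map_cons, Program.seqList, Program.writesNat,
              Bool.or_eq_false_iff] at ha
            rcases List.mem_cons.1 hx with rfl | hx
            · exact ha.1
            · exact ihL hx ha.2
        · induction L with
          | nil => simp at hx
          | cons z L ihL =>
            simp only [List.map_cons, Program.seqList, Program.writesReal,
              Bool.or_eq_false_iff] at ha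
            rcases List.mem_cons.1 hx with rfl | hx
            · exact ha.1
            · exact ihL hx ha.2
      have := ih (insert x S) ρ (fun y hy => hL' y (by simp [hy])) (hF.trans hFx) hρ
      have hset : S ∪ {y | y ∈ x :: L'} = insert x S ∪ {y | y ∈ L'} := by
        ext y; simp only [Set.mem_union, Set.mem_ofPred_eq, List.mem_cons, Set.mem_insert_iff]
        tauto
      rw [hset]
      exact this
  simpa using key L ∅ σ (fun _ h => h) (Frame.refl _ _) h0

end Runs

/-! ### Transportation arrays whose support carries no circulation -/

section Transport

variable {α β : Type*} [Fintype α] [Fintype β]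

/-- The only array that vanishes where `X` vanishes and that has zero row and column sums is
zero. -/
def NoCirculation (X : α → β → ℝ) : Prop :=
  ∀ δ : α → β → ℝ, (∀ i o, X i o = 0 → δ i o = 0) → (∀ i, ∑ o, δ i o = 0) →
    (∀ o, ∑ i, δ i o = 0) → ∀ i o, δ i o = 0

/-- A circulation inside the support can be added with growing multiplicity, in the direction that
does not raise the cost, until the first entry drops to zero. -/
theorem exists_smaller_support {w X : α → β → ℝ} (hX : ∀ i o, 0 ≤ X i o)
    (h : ¬ NoCirculation X) :
    ∃ X' : α → β → ℝ, (∀ i o, 0 ≤ X' i o) ∧ (∀ i, ∑ o, X' i o = ∑ o, X i o) ∧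
      (∀ o, ∑ i, X' i o = ∑ i, X i o) ∧ ∑ i, ∑ o, w i o * X' i o ≤ ∑ i, ∑ o, w i o * X i o ∧
      {p : α × β | X' p.1 p.2 ≠ 0}.ncard < {p : α × β | X p.1 p.2 ≠ 0}.ncard := by
  have h' : ∃ δ : α → β → ℝ, (∀ i o, X i o = 0 → δ i o = 0) ∧ (∀ i, ∑ o, δ i o = 0) ∧
      (∀ o, ∑ i, δ i o = 0) ∧ (∃ i o, δ i o ≠ 0) ∧ ∑ i, ∑ o, w i o * δ i o ≤ 0 := by
    simp only [NoCirculation, not_forall] at h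
    obtain ⟨δ, h0, hr, hc, i, o, hne⟩ := h
    rcases le_total (∑ i, ∑ o, w i o * δ i o) 0 with hw | hw
    · exact ⟨δ, h0, hr, hc, ⟨i, o, hne⟩, hw⟩
    · refine ⟨fun i o => - δ i o, fun i o h => by simp [h0 i o h], fun i => by simp [hr],
        fun o => by simp [hc], ⟨i, o, by simpa using hne⟩, by simpa using hw⟩
  obtain ⟨δ, h0, hr, hc, ⟨i₀, o₀, hne⟩, hw⟩ := h'
  -- A row with a nonzero entry and zero sum cannot be nonnegative.
  have hneg : ∃ p : α × β, δ p.1 p.2 < 0 := by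
    by_contra hcon
    push Not at hcon
    have := (Finset.sum_eq_zero_iff_of_nonneg (fun o _ => hcon (i₀, o))).1 (hr i₀) o₀ (by simp)
    exact hne this
  classical
  -- Ratio test: `p` is the position that blocks first, and it leaves the support.
  obtain ⟨p, hp, hmin⟩ := Finset.exists_min_image
    (Finset.univ.filter fun p : α × β => δ p.1 p.2 < 0) (fun p => X p.1 p.2 / (- δ p.1 p.2))
    (by obtain ⟨p, hp⟩ := hneg; exact ⟨p, by simpa using hp⟩)
  simp only [Finset.mem_filter, Finset.mem_univ, true_and] at hp hmin
  set ε := X p.1 p.2 / (- δ p.1 p.2) with hε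
  have hε0 : 0 ≤ ε := div_nonneg (hX _ _) (by linarith)
  refine ⟨fun i o => X i o + ε * δ i o, fun i o => ?_, fun i => ?_, fun o => ?_, ?_, ?_⟩
  · rcases lt_or_ge (δ i o) 0 with hlt | hge
    · have := hmin (i, o) hlt
      rw [le_div_iff₀ (by simpa using hlt)] at this
      simp only at this
      linarith
    · exact add_nonneg (hX _ _) (mul_nonneg hε0 hge)
  · simp [Finset.sum_add_distrib, ← Finset.mul_sum, hr]
  · simp [Finset.sum_add_distrib, ← Finset.mul_sum, hc]
  · have : ∑ i, ∑ o, w i o * (X i o + ε * δ i o)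
        = ∑ i, ∑ o, w i o * X i o + ε * ∑ i, ∑ o, w i o * δ i o := by
      simp only [Finset.mul_sum, ← Finset.sum_add_distrib]
      exact Finset.sum_congr rfl fun i _ => Finset.sum_congr rfl fun o _ => by ring
    rw [this]
    nlinarith [mul_nonneg hε0 (neg_nonneg.2 hw)]
  · refine Set.ncard_lt_ncard ⟨fun q hq hq' => hq ?_, fun hsub => ?_⟩ (Set.toFinite _)
    · simp [hq', h0 _ _ hq']
    · have hpX : X p.1 p.2 ≠ 0 := fun h => by have := h0 _ _ h; linarith
      refine hsub (a := p) hpX ?_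
      have : δ p.1 p.2 ≠ 0 := hp.ne
      simp only [hε]
      field_simp
      ring

theorem exists_noCirculation (w : α → β → ℝ) {X : α → β → ℝ} (hX : ∀ i o, 0 ≤ X i o) :
    ∃ X' : α → β → ℝ, (∀ i o, 0 ≤ X' i o) ∧ (∀ i, ∑ o, X' i o = ∑ o, X i o) ∧
      (∀ o, ∑ i, X' i o = ∑ i, X i o) ∧ ∑ i, ∑ o, w i o * X' i o ≤ ∑ i, ∑ o, w i o * X i o ∧
      NoCirculation X' := by
  induction hk : {p : α × β | X p.1 p.2 ≠ 0}.ncard using Nat.strong_induction_on generalizing X with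
  | _ k ih =>
    by_cases h : NoCirculation X
    · exact ⟨X, hX, fun _ => rfl, fun _ => rfl, le_rfl, h⟩
    · obtain ⟨X₁, hX₁, hr, hc, hw, hlt⟩ := exists_smaller_support (w := w) hX h
      obtain ⟨X₂, hX₂, hr₂, hc₂, hw₂, hN⟩ := ih _ (hk ▸ hlt) hX₁ rfl
      exact ⟨X₂, hX₂, fun i => (hr₂ i).trans (hr i), fun o => (hc₂ o).trans (hc o),
        hw₂.trans hw, hN⟩

/-- At most as many rows as there are columns minus one have two nonzero entries. -/
theorem NoCirculation.card_le {γ : Type*} [Fintype γ] {X : α → Option γ → ℝ}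
    (hX : NoCirculation X) (T : Finset α)
    (hT : ∀ i ∈ T, ∃ o o', o ≠ o' ∧ X i o ≠ 0 ∧ X i o' ≠ 0) : T.card ≤ Fintype.card γ := by
  classical
  choose! o o' hne ho ho' using hT
  -- Each row of `T` contributes a zero-sum vector supported on two of its support columns. Such
  -- vectors are determined by their `some` coordinates, so more than `Fintype.card γ` of them are
  -- dependent, and a dependence is a circulation.
  set u : α → Option γ → ℝ := fun i => Pi.single (o i) 1 - Pi.single (o' i) 1 with hu
  have husum : ∀ i, ∑ q, u i q = 0 := fun i => by simp [hu]
  by_contra hlt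
  push Not at hlt
  have hdep : ¬ LinearIndependent ℝ (fun (i : T) (j : γ) => u i (some j)) := fun hli => by
    have := hli.fintype_card_le_finrank
    simp at this
    omega
  rw [Fintype.not_linearIndependent_iff] at hdep
  obtain ⟨g, hg, i₀, hi₀⟩ := hdep
  set g' : α → ℝ := fun i => if h : i ∈ T then g ⟨i, h⟩ else 0 with hg'
  have hsome : ∀ j : γ, ∑ i, g' i * u i (some j) = 0 := fun j => by
    have := congrFun hg j
    simp only [Finset.sum_apply, Pi.smul_apply, smul_eq_mul, Pi.zero_apply] at this
    rw [← this, ← Finset.sum_subset (Finset.subset_univ T), ← Finset.sum_coe_sort]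
    · exact Finset.sum_congr rfl fun i _ => by simp [hg']
    · intro i _ hi; simp [hg', hi]
  have hrow : ∀ i, ∑ q, g' i * u i q = 0 := fun i => by rw [← Finset.mul_sum, husum, mul_zero]
  have := hX (fun i q => g' i * u i q) ?_ hrow ?_ i₀ (o i₀)
  · simp [hg', hu, hi₀, hne i₀ i₀.2] at this
  · intro i q hq
    by_cases hi : i ∈ T
    · have h1 : q ≠ o i := fun h => ho i hi (h ▸ hq)
      have h2 : q ≠ o' i := fun h => ho' i hi (h ▸ hq)
      simp [hu, h1, h2]
    · simp [hg', hi]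
  -- The column `none` was dropped from the dependence; its sum vanishes because all rows and all
  -- other columns have sum zero.
  · rintro (_ | j)
    · have : ∑ q, ∑ i, g' i * u i q = 0 := by rw [Finset.sum_comm]; simp [hrow]
      rwa [Fintype.sum_option, Finset.sum_eq_zero (fun j _ => hsome j), add_zero] at this
    · exact hsome j

/-- Deleting a support entry of an array without circulation separates the columns: there is a
set of columns, containing that of the entry, such that the row of the entry meets it in the entry
only, and every other row has its support inside or outside. -/
theorem NoCirculation.exists_cut {X : α → β → ℝ} (hX : NoCirculation X) {i₀ : α} {o₀ : β}
    (h₀ : X i₀ o₀ ≠ 0) :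
    ∃ K : Set β, o₀ ∈ K ∧ (∀ o ∈ K, o ≠ o₀ → X i₀ o = 0) ∧
      ∀ i ≠ i₀, (∀ o ∈ K, X i o = 0) ∨ ∀ o ∉ K, X i o = 0 := by
  classical
  -- Two columns are adjacent if some row joins them by support entries other than the deleted one;
  -- `K` will be the component of `o₀`.
  set r : β → β → Prop := fun o o' => ∃ i, X i o ≠ 0 ∧ X i o' ≠ 0 ∧ (i, o) ≠ (i₀, o₀) ∧
    (i, o') ≠ (i₀, o₀) with hr
  -- A path from `o₀` to `o` carries a unit flow that avoids the deleted entry.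
  have flow : ∀ o, Relation.ReflTransGen r o₀ o → ∃ δ : α → β → ℝ,
      (∀ i q, X i q = 0 → δ i q = 0) ∧ (∀ i, ∑ q, δ i q = 0) ∧
      (∀ q, ∑ i, δ i q = (Pi.single o₀ 1 - Pi.single o 1 : β → ℝ) q) ∧ δ i₀ o₀ = 0 := by
    intro o ho
    induction ho with
    | refl => exact ⟨0, by simp, by simp, by simp, rfl⟩
    | @tail o o' _ hstep ih =>
      obtain ⟨δ, h1, h2, h3, h4⟩ := ih
      obtain ⟨i, ha, hb, hc, hd⟩ := hstep
      refine ⟨δ + Pi.single i (Pi.single o 1 - Pi.single o' 1), ?_, ?_, ?_, ?_⟩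
      · intro i' q hq
        by_cases hi : i' = i
        · subst hi
          have e1 : q ≠ o := fun h => ha (h ▸ hq)
          have e2 : q ≠ o' := fun h => hb (h ▸ hq)
          simp [h1 _ _ hq, e1, e2]
        · simp [h1 _ _ hq, hi]
      · intro i'
        by_cases hi : i' = i
        · subst hi; simp [Finset.sum_add_distrib, h2]
        · simp [hi, h2]
      · intro q
        simp only [Pi.add_apply, Finset.sum_add_distrib, h3]
        rw [Finset.sum_eq_single i (fun b _ hb => by simp [hb]) (by simp)]
        simp only [Pi.single_eq_same, Pi.sub_apply]
        ring
      · by_cases hi : i₀ = i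
        · subst hi
          have e1 : o₀ ≠ o := fun h => hc (by rw [h])
          have e2 : o₀ ≠ o' := fun h => hd (by rw [h])
          simp [h4, e1, e2]
        · simp [h4, hi]
  refine ⟨{o | Relation.ReflTransGen r o₀ o}, Relation.ReflTransGen.refl, ?_, ?_⟩
  · intro o ho hne
    by_contra hXo
    obtain ⟨δ, h1, h2, h3, h4⟩ := flow o ho
    -- Closing the path through row `i₀` would give a circulation that does not vanish at `(i₀,
    -- o₀)`.
    have := hX (δ + Pi.single i₀ (Pi.single o 1 - Pi.single o₀ 1)) ?_ ?_ ?_ i₀ o₀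
    · simp [h4, hne.symm] at this
    · intro i' q hq
      by_cases hi : i' = i₀
      · subst hi
        have e1 : q ≠ o := fun h => hXo (h ▸ hq)
        have e2 : q ≠ o₀ := fun h => h₀ (h ▸ hq)
        simp [h1 _ _ hq, e1, e2]
      · simp [h1 _ _ hq, hi]
    · intro i'
      by_cases hi : i' = i₀
      · subst hi; simp [Finset.sum_add_distrib, h2]
      · simp [hi, h2]
    · intro q
      simp only [Pi.add_apply, Finset.sum_add_distrib, h3]
      rw [Finset.sum_eq_single i₀ (fun b _ hb => by simp [hb]) (by simp)]
      simp only [Pi.single_eq_same, Pi.sub_apply]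
      ring
  · intro i hi
    by_contra hcon
    push Not at hcon
    obtain ⟨⟨o, ho, hXo⟩, o', ho', hXo'⟩ := hcon
    exact ho' (Relation.ReflTransGen.tail ho ⟨i, hXo, hXo', by simp [hi], by simp [hi]⟩)

end Transport

/-! ### Residues -/

/-- One step of the reduction modulo `s`. -/
noncomputable def reduce (s r : ℝ) : ℝ := if s ≤ r then r - s else r

/-- Below `s` further steps do nothing, so any number of steps not smaller than the quotient is
enough. -/
theorem reduce_iterate {s r u : ℝ} {a n : ℕ} (ha : a ≤ n) (hr0 : 0 ≤ r) (hr : r < s)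
    (hu : u = a * s + r) : (reduce s)^[n] u = r := by
  induction n generalizing a u with
  | zero =>
    obtain rfl : a = 0 := by omega
    simpa using hu
  | succ n ih =>
    rw [Function.iterate_succ_apply]
    rcases a with _ | a
    · refine ih (a := 0) (by omega) ?_
      rw [reduce, if_neg (by rw [hu]; push_cast; linarith), hu]
    · refine ih (a := a) (by omega) ?_
      have : s ≤ u := by
        rw [hu]; push_cast
        nlinarith [mul_nonneg (Nat.cast_nonneg (α := ℝ) a) (hr0.trans hr.le)]
      rw [reduce, if_pos this, hu]
      push_cast; ring

/-! ### Forest-supported solutions have residues as entries -/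

namespace UniformInstance

variable {m n : ℕ}

/-- The residue modulo `s` of the total demand of a set of clients, or `s` minus that residue. -/
noncomputable def residue (I : UniformInstance m n) (e : Finset (Fin m) × Bool) : ℝ :=
  if e.2 then I.s - (reduce I.s)^[n] (∑ k ∈ e.1, I.d k)
  else (reduce I.s)^[n] (∑ k ∈ e.1, I.d k)

/-- In the application `a` counts facilities, which is why the `n` reduction steps in `residue`
suffice. -/
theorem residue_eq_of_sum_eq (I : UniformInstance m n) {K : Finset (Fin m)} {x : ℝ} {a : ℕ}
    (ha : a ≤ n) (hx0 : 0 ≤ x) (hxs : x < I.s) (h : ∑ k ∈ K, I.d k = a * I.s + x) :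
    I.residue (K, false) = x ∧ I.residue (K, true) = I.s - x := by
  simp [residue, reduce_iterate ha hx0 hxs h]

/-- This names the boundary values `0` and `s`, for which the cut argument is not needed. -/
theorem residue_empty (I : UniformInstance m n) :
    I.residue (∅, false) = 0 ∧ I.residue (∅, true) = I.s := by
  have := I.residue_eq_of_sum_eq (K := ∅) (x := 0) (a := 0) (by simp) le_rfl I.s_pos (by simp)
  simpa using this

/-- Every instance has, below any feasible solution, one in which all but `m` facilities are
unused or ship their whole capacity to one client, and all amounts are residues. -/
theorem exists_structured (I : UniformInstance m n) {x : Fin n → Fin m → ℝ} {y : Fin n → ℕ}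
    (h : I.IsFeasible x y) :
    ∃ x' : Fin n → Fin m → ℝ, I.IsFeasible x' y ∧ I.totalCost x' y ≤ I.totalCost x y ∧
      (∀ i j, ∃ e, x' i j = I.residue e) ∧
      ∃ T : Finset (Fin n), T.card ≤ m ∧
        ∀ i ∉ T, x' i = 0 ∨ ∃ j, x' i = Pi.single j I.s := by
  classical
  -- The column `none` takes the unused capacity of open facilities, so that row sums become
  -- equalities; it has cost `0`.
  set X : Fin n → Option (Fin m) → ℝ := fun i o =>
    o.elim (I.s * y i - ∑ j, x i j) (x i) with hXdef
  have hXrow : ∀ i, ∑ o, X i o = I.s * y i := fun i => by simp [hXdef, Fintype.sum_option]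
  have hX0 : ∀ i o, 0 ≤ X i o := by
    rintro i (_ | j)
    · simpa [hXdef] using h.capacity i
    · exact h.nonneg i j
  obtain ⟨Z, hZ0, hZr, hZc, hZw, hZ⟩ :=
    exists_noCirculation (fun i o => o.elim 0 (I.c i)) hX0
  have hrow : ∀ i, ∑ o, Z i o = I.s * y i := fun i => (hZr i).trans (hXrow i)
  have hcol : ∀ j, ∑ i, Z i (some j) = I.d j := fun j =>
    (hZc (some j)).trans (by simpa [hXdef] using h.demand j)
  have hle : ∀ i o, Z i o ≤ I.s * y i := fun i o => by
    rw [← hrow i]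
    exact Finset.single_le_sum (f := fun o => Z i o) (fun o _ => hZ0 i o) (Finset.mem_univ o)
  have hpos : ∀ i o, Z i o ≠ 0 → y i = 1 := fun i o hne => by
    rcases h.binary i with h0 | h1
    · exact absurd (le_antisymm (by simpa [h0] using hle i o) (hZ0 i o)) hne
    · exact h1
  refine ⟨fun i j => Z i (some j), ⟨hcol, fun i => ?_, h.cardinality, fun i j => hZ0 _ _,
    h.binary⟩, ?_, fun i j => ?_,
    Finset.univ.filter fun i => ∃ o o', o ≠ o' ∧ Z i o ≠ 0 ∧ Z i o' ≠ 0, ?_, fun i hi => ?_⟩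
  · rw [← hrow i, Fintype.sum_option]
    linarith [hZ0 i none]
  · simp only [totalCost]
    have := hZw
    simp only [Fintype.sum_option, Option.elim, zero_mul, zero_add, hXdef] at this
    linarith
  · rcases eq_or_ne (Z i (some j)) 0 with h0 | hne
    · exact ⟨_, h0.trans I.residue_empty.1.symm⟩
    have hy := hpos i _ hne
    have hlt0 : 0 < Z i (some j) := lt_of_le_of_ne (hZ0 _ _) hne.symm
    have hles : Z i (some j) ≤ I.s := by simpa [hy] using hle i (some j)
    rcases hles.eq_or_lt with heq | hlts
    · exact ⟨_, heq.trans I.residue_empty.2.symm⟩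
    -- The demands are summed over the side of the cut that lacks the slack column. Every row other
    -- than `i` contributes `0` or `s` there.
    obtain ⟨K, hjK, hKi, hK⟩ := hZ.exists_cut hne
    by_cases hnone : none ∈ K
    · -- the complement of the cut consists of genuine clients
      set J : Finset (Fin m) := Finset.univ.filter fun k => some k ∉ K with hJ
      set A : Finset (Fin n) := Finset.univ.filter fun i' => i' ≠ i ∧ ∃ o ∉ K, Z i' o ≠ 0 with hA
      have hin : ∀ i', ∑ k ∈ J, Z i' (some k) = ∑ o, if o ∈ K then 0 else Z i' o := fun i' => by
        rw [Fintype.sum_option]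
        simp [hnone, hJ, Finset.sum_filter, ite_not]
      have hrowJ : ∀ i', ∑ k ∈ J, Z i' (some k) =
          if i' = i then I.s - Z i (some j) else if i' ∈ A then I.s else 0 := by
        intro i'
        rw [hin]
        split_ifs with h1 h2
        · subst h1
          have := hrow i'
          rw [hy, Nat.cast_one, mul_one] at this
          rw [← this, eq_sub_iff_add_eq, ← Finset.sum_erase_add _ _ (Finset.mem_univ (some j)),
            ← Finset.sum_erase_add _ (fun o => Z i' o) (Finset.mem_univ (some j))]
          simp only [hjK, if_true, add_zero]
          congr 1
          refine Finset.sum_congr rfl fun o ho => ?_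
          split_ifs with hoK
          · exact (hKi o hoK (Finset.ne_of_mem_erase ho)).symm
          · rfl
        · simp only [hA, Finset.mem_filter, Finset.mem_univ, true_and] at h2
          obtain ⟨_, o, hoK, hoZ⟩ := h2
          have hy' := hpos i' o hoZ
          have := hrow i'
          rw [hy', Nat.cast_one, mul_one] at this
          rw [← this]
          refine Finset.sum_congr rfl fun q _ => ?_
          split_ifs with hqK
          · rcases hK i' h1 with h' | h'
            · exact (h' q hqK).symm
            · exact absurd (h' o hoK) hoZ
          · rfl
        · refine Finset.sum_eq_zero fun o _ => ?_
          split_ifs with hoK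
          · rfl
          · by_contra hoZ
            exact h2 (by simp only [hA, Finset.mem_filter, Finset.mem_univ, true_and]
                         exact ⟨h1, o, hoK, hoZ⟩)
      -- Row `i` meets `K` only in the entry itself, so the rest of its capacity lies on the
      -- complementary side.
      have hsum : ∑ k ∈ J, I.d k = A.card * I.s + (I.s - Z i (some j)) := by
        simp only [← hcol]
        rw [Finset.sum_comm]
        simp only [hrowJ]
        rw [← Finset.add_sum_erase _ _ (Finset.mem_univ i), if_pos rfl, add_comm]
        congr 1
        rw [Finset.sum_congr rfl (g := fun i' => if i' ∈ A then I.s else 0)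
          (fun i' hi' => by rw [if_neg (Finset.ne_of_mem_erase hi')]), ← Finset.sum_filter,
          Finset.sum_const, nsmul_eq_mul]
        congr 3
        ext i'
        simp only [Finset.mem_filter, Finset.mem_erase, Finset.mem_univ, and_true, hA, true_and]
        tauto
      have := I.residue_eq_of_sum_eq (A.card_le_univ.trans (by simp)) (by linarith)
        (by linarith) hsum
      exact ⟨_, by rw [this.2]; ring⟩
    · set J : Finset (Fin m) := Finset.univ.filter fun k => some k ∈ K with hJ
      set A : Finset (Fin n) := Finset.univ.filter fun i' => i' ≠ i ∧ ∃ o ∈ K, Z i' o ≠ 0 with hA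
      have hin : ∀ i', ∑ k ∈ J, Z i' (some k) = ∑ o, if o ∈ K then Z i' o else 0 := fun i' => by
        rw [Fintype.sum_option]
        simp [hnone, hJ, Finset.sum_filter]
      have hrowJ : ∀ i', ∑ k ∈ J, Z i' (some k) =
          if i' = i then Z i (some j) else if i' ∈ A then I.s else 0 := by
        intro i'
        rw [hin]
        split_ifs with h1 h2
        · subst h1
          rw [Finset.sum_eq_single (some j)]
          · simp [hjK]
          · intro o _ ho
            split_ifs with hoK
            · exact hKi o hoK ho
            · rfl
          · simp
        · simp only [hA, Finset.mem_filter, Finset.mem_univ, true_and] at h2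
          obtain ⟨_, o, hoK, hoZ⟩ := h2
          have hy' := hpos i' o hoZ
          have := hrow i'
          rw [hy', Nat.cast_one, mul_one] at this
          rw [← this]
          refine Finset.sum_congr rfl fun q _ => ?_
          split_ifs with hqK
          · rfl
          · rcases hK i' h1 with h' | h'
            · exact absurd (h' o hoK) hoZ
            · exact (h' q hqK).symm
        · refine Finset.sum_eq_zero fun o _ => ?_
          split_ifs with hoK
          · by_contra hoZ
            exact h2 (by simp only [hA, Finset.mem_filter, Finset.mem_univ, true_and]
                         exact ⟨h1, o, hoK, hoZ⟩)
          · rfl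
      have hsum : ∑ k ∈ J, I.d k = A.card * I.s + Z i (some j) := by
        simp only [← hcol]
        rw [Finset.sum_comm]
        simp only [hrowJ]
        rw [← Finset.add_sum_erase _ _ (Finset.mem_univ i), if_pos rfl, add_comm]
        congr 1
        rw [Finset.sum_congr rfl (g := fun i' => if i' ∈ A then I.s else 0)
          (fun i' hi' => by rw [if_neg (Finset.ne_of_mem_erase hi')]), ← Finset.sum_filter,
          Finset.sum_const, nsmul_eq_mul]
        congr 3
        ext i'
        simp only [Finset.mem_filter, Finset.mem_erase, Finset.mem_univ, and_true, hA, true_and]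
        tauto
      have := I.residue_eq_of_sum_eq (A.card_le_univ.trans (by simp)) hlt0.le hlts hsum
      exact ⟨_, this.1.symm⟩
  · have := hZ.card_le (Finset.univ.filter fun i => ∃ o o', o ≠ o' ∧ Z i o ≠ 0 ∧ Z i o' ≠ 0)
      (fun i hi => by simpa using hi)
    simpa using this
  · simp only [Finset.mem_filter, Finset.mem_univ, true_and, not_exists, not_and, not_not] at hi
    by_cases hz : ∀ j, Z i (some j) = 0
    · exact Or.inl (funext hz)
    · push Not at hz
      obtain ⟨j, hj⟩ := hz
      refine Or.inr ⟨j, ?_⟩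
      have hother : ∀ o, o ≠ some j → Z i o = 0 := fun o ho => hi (some j) o ho.symm hj
      have hs : Z i (some j) = I.s := by
        have := hrow i
        rw [hpos i _ hj, Nat.cast_one, mul_one,
          Finset.sum_eq_single (some j) (fun o _ ho => hother o ho) (by simp)] at this
        exact this
      funext k
      by_cases hk : k = j
      · subst hk; simp [hs]
      · change Z i (some k) = _
        rw [hother (some k) (by simpa using hk), Pi.single_eq_of_ne hk]

end UniformInstance

/-! ### Chains of row types

The facilities are processed in order, and each of them gets a row type `r`: it stays closed
(`r = 0`), it ships its whole capacity to client `r - 1` (`1 ≤ r ≤ m`), or it is the `t`-th special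
facility (`r = m + 1 + t`). -/

/-- `1` for the types of special facilities, `0` for the other types. -/
def specialInc (m r : ℕ) : ℕ := 1 - (1 - (r - m))

theorem specialInc_of_le {m r : ℕ} (h : r ≤ m) : specialInc m r = 0 := by
  unfold specialInc; omega

theorem specialInc_of_lt {m r : ℕ} (h : m < r) : specialInc m r = 1 := by
  unfold specialInc; omega

/-- The weight of a type: distinct powers of `B` for the types `1, …, m`. -/
def typeWeight (m B r : ℕ) : ℕ := if 1 ≤ r ∧ r ≤ m then B ^ (r - 1) else 0

/-- `1` for the types of open facilities. -/
def used (r : ℕ) : ℕ := if r = 0 then 0 else 1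

/-- The type `r` may stand at the end of a sequence with `h` special types and total weight `Q`. -/
def Step (m : ℕ) (w : ℕ → ℕ) (h Q r : ℕ) : Prop := (r ≤ m ∨ r = m + h) ∧ w r ≤ Q

/-- The first `i` terms of `a` contain the special types `m + 1, …, m + h` in this order, and
have total weight `Q`. -/
def Chain (m : ℕ) (w : ℕ → ℕ) : ℕ → ℕ → ℕ → (ℕ → ℕ) → Prop
  | 0, h, Q, _ => h = 0 ∧ Q = 0
  | i + 1, h, Q, a =>
    Step m w h Q (a i) ∧ Chain m w i (h - specialInc m (a i)) (Q - w (a i)) a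

namespace Chain

variable {m : ℕ} {w : ℕ → ℕ} {i h Q : ℕ} {a : ℕ → ℕ}

theorem sum_weight (hc : Chain m w i h Q a) : ∑ k ∈ Finset.range i, w (a k) = Q := by
  induction i generalizing h Q with
  | zero => simp [hc.2]
  | succ i ih =>
    obtain ⟨hs, hc⟩ := hc
    rw [Finset.sum_range_succ, ih hc]
    exact Nat.sub_add_cancel hs.2

theorem type_cases (hc : Chain m w i h Q a) {k : ℕ} (hk : k < i) :
    a k ≤ m ∨ ∃ t < h, a k = m + 1 + t := by
  induction i generalizing h Q with
  | zero => omega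
  | succ i ih =>
    obtain ⟨hs, hc⟩ := hc
    rcases Nat.lt_succ_iff_lt_or_eq.1 hk with hk | rfl
    · rcases ih hc hk with h1 | ⟨t, ht, h1⟩
      · exact Or.inl h1
      · exact Or.inr ⟨t, by omega, h1⟩
    · rcases hs.1 with h1 | h1
      · exact Or.inl h1
      · by_cases h0 : h = 0
        · exact Or.inl (by omega)
        · exact Or.inr ⟨h - 1, by omega, by omega⟩

/-- Read backwards, the counter `h` falls to `0` in unit steps, and each step uses up exactly one
special type. -/
theorem exists_special (hc : Chain m w i h Q a) {t : ℕ} (ht : t < h) :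
    ∃ k < i, a k = m + 1 + t := by
  induction i generalizing h Q with
  | zero => obtain ⟨rfl, -⟩ := hc; omega
  | succ i ih =>
    obtain ⟨hs, hc⟩ := hc
    by_cases h' : t < h - specialInc m (a i)
    · obtain ⟨k, hk, h1⟩ := ih hc h'
      exact ⟨k, by omega, h1⟩
    · rcases le_or_gt (a i) m with h1 | h1
      · rw [specialInc_of_le h1] at h'; omega
      · rw [specialInc_of_lt h1] at h'
        have := hs.1
        exact ⟨i, by omega, by omega⟩

/-- A sum over a chain is determined by the number of special types and the multiplicities of the
types `1, …, m`. -/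
theorem sum_eq {M : Type*} [AddCommMonoid M] {F : ℕ → M} (hF : F 0 = 0) (hc : Chain m w i h Q a) :
    ∑ k ∈ Finset.range i, F (a k) = ∑ t ∈ Finset.range h, F (m + 1 + t) +
      ∑ j ∈ Finset.range m, ((Finset.range i).filter (a · = j + 1)).card • F (j + 1) := by
  induction i generalizing h Q with
  | zero => obtain ⟨rfl, -⟩ := hc; simp
  | succ i ih =>
    obtain ⟨hs, hc⟩ := hc
    have hcard : ∀ j, ((Finset.range (i + 1)).filter (a · = j + 1)).card • F (j + 1) =
        ((Finset.range i).filter (a · = j + 1)).card • F (j + 1) +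
          if a i = j + 1 then F (j + 1) else 0 := by
      intro j
      rw [Finset.range_add_one, Finset.filter_insert]
      split_ifs with h1
      · rw [Finset.card_insert_of_notMem (by simp), add_smul, one_smul]
      · rw [add_zero]
    rw [Finset.sum_range_succ, ih hc]
    simp only [hcard, Finset.sum_add_distrib]
    rcases le_or_gt (a i) m with h1 | h1
    · rw [specialInc_of_le h1, Nat.sub_zero, add_assoc]
      congr 2
      rcases Nat.eq_zero_or_pos (a i) with h0 | h0
      · rw [h0, hF]
        exact (Finset.sum_eq_zero fun j _ => if_neg (by omega)).symm
      · rw [Finset.sum_eq_single (a i - 1)]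
        · rw [if_pos (by omega)]; congr 1; omega
        · intro j _ hj; exact if_neg (by omega)
        · intro hj; simp at hj; omega
    · have h2 : a i = m + h := by have := hs.1; omega
      obtain ⟨h, rfl⟩ : ∃ h', h = h' + 1 := ⟨h - 1, by omega⟩
      rw [specialInc_of_lt h1, Nat.add_sub_cancel, Finset.sum_range_succ,
        Finset.sum_eq_zero (s := Finset.range m) (f := fun j => if a i = j + 1 then F (j + 1) else 0)
          (fun j hj => if_neg (by have := Finset.mem_range.1 hj; omega)), h2]
      rw [add_zero, show m + 1 + h = m + (h + 1) by ring]
      exact add_right_comm _ _ _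

theorem card_filter_lt (a : ℕ → ℕ) (i r : ℕ) :
    ((Finset.range i).filter (a · = r)).card < i + 1 :=
  Nat.lt_succ_of_le ((Finset.card_filter_le _ _).trans (by simp))

/-- Each multiplicity is at most `i`, so in base `i + 1` no carries occur, and the multiplicities
are the digits of `Q`. -/
theorem weight_eq (hc : Chain m (typeWeight m (i + 1)) i h Q a) :
    Q = finFunctionFinEquiv (fun j : Fin m => (⟨_, card_filter_lt a i (j + 1)⟩ : Fin (i + 1))) := by
  have := hc.sum_eq (F := typeWeight m (i + 1)) (by simp [typeWeight])
  rw [hc.sum_weight, Finset.sum_eq_zero (s := Finset.range h)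
    (fun t _ => by rw [typeWeight, if_neg (by omega)]), zero_add,
    ← Fin.sum_univ_eq_sum_range (fun j => ((Finset.range i).filter (a · = j + 1)).card •
      typeWeight m (i + 1) (j + 1))] at this
  rw [this, finFunctionFinEquiv_apply]
  refine Finset.sum_congr rfl fun j _ => ?_
  rw [typeWeight, if_pos ⟨by omega, by omega⟩, smul_eq_mul, Nat.add_sub_cancel]

theorem weight_lt (hc : Chain m (typeWeight m (i + 1)) i h Q a) : Q < (i + 1) ^ m := by
  rw [hc.weight_eq]; exact Fin.is_lt _

/-- The parameters of a chain determine all sums over it. -/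
theorem sum_congr {M : Type*} [AddCommMonoid M] {F : ℕ → M} (hF : F 0 = 0) {a' : ℕ → ℕ}
    (hc : Chain m (typeWeight m (i + 1)) i h Q a) (hc' : Chain m (typeWeight m (i + 1)) i h Q a') :
    ∑ k ∈ Finset.range i, F (a k) = ∑ k ∈ Finset.range i, F (a' k) := by
  rw [hc.sum_eq hF, hc'.sum_eq hF]
  congr 1
  have h1 := hc.weight_eq.symm.trans hc'.weight_eq
  have h2 := finFunctionFinEquiv.injective (Fin.ext h1)
  refine Finset.sum_congr rfl fun j hj => ?_
  have h3 := congrFun h2 ⟨j, Finset.mem_range.1 hj⟩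
  simp only [Fin.mk.injEq] at h3
  rw [h3]

/-- Numbering the special facilities in their order of appearance always yields a chain. -/
theorem of_forall {n : ℕ}
    (ha : ∀ k < n, a k ≤ m ∨ a k = m + 1 + ∑ l ∈ Finset.range k, specialInc m (a l)) :
    Chain m w n (∑ l ∈ Finset.range n, specialInc m (a l)) (∑ l ∈ Finset.range n, w (a l)) a := by
  induction n with
  | zero => exact ⟨by simp, by simp⟩
  | succ n ih =>
    refine ⟨⟨?_, ?_⟩, ?_⟩
    · rcases ha n (by omega) with h1 | h1
      · exact Or.inl h1
      · refine Or.inr ?_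
        rw [Finset.sum_range_succ, specialInc_of_lt (by omega : m < a n)]
        omega
    · rw [Finset.sum_range_succ]; omega
    · rw [Finset.sum_range_succ, Finset.sum_range_succ, Nat.add_sub_cancel, Nat.add_sub_cancel]
      exact ih fun k hk => ha k (by omega)

end Chain

/-! ### Dynamic programming over chains -/

/-- Tables of the dynamic program: whether an entry `(i, h, Q)` is attained, the least cost of a
chain, and the last type of a cheapest chain. -/
structure Tables where
  valid : ℕ → ℕ → ℕ → ℕ
  val : ℕ → ℕ → ℕ → ℝ
  dec : ℕ → ℕ → ℕ → ℕ

namespace Tables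

/-- The entry `(i + 1, h, Q)` is the optimum over the last types `r < R`. -/
structure CellCorrect (D : Tables) (m : ℕ) (w : ℕ → ℕ) (C : ℕ → ℕ → ℝ) (R i h Q : ℕ) : Prop where
  sound : 1 ≤ D.valid (i + 1) h Q → Step m w h Q (D.dec (i + 1) h Q) ∧
    1 ≤ D.valid i (h - specialInc m (D.dec (i + 1) h Q)) (Q - w (D.dec (i + 1) h Q)) ∧
    D.val (i + 1) h Q = D.val i (h - specialInc m (D.dec (i + 1) h Q))
      (Q - w (D.dec (i + 1) h Q)) + C i (D.dec (i + 1) h Q)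
  complete : ∀ r < R, Step m w h Q r → 1 ≤ D.valid i (h - specialInc m r) (Q - w r) →
    1 ≤ D.valid (i + 1) h Q ∧
      D.val (i + 1) h Q ≤ D.val i (h - specialInc m r) (Q - w r) + C i r

/-- The entries `(i, h, Q)` with `i ≤ n`, `h ≤ m` and `Q < N` are correct. -/
structure Correct (D : Tables) (m : ℕ) (w : ℕ → ℕ) (C : ℕ → ℕ → ℝ) (n N : ℕ) : Prop where
  base : ∀ h ≤ m, ∀ Q < N, (1 ≤ D.valid 0 h Q ↔ h = 0 ∧ Q = 0)
  base_val : D.val 0 0 0 = 0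
  step : ∀ i < n, ∀ h ≤ m, ∀ Q < N, D.CellCorrect m w C (2 * m + 1) i h Q

/-- The first `i` terms of `a` are recorded in the tables, backwards from the entry `(i, h, Q)`. -/
def Recorded (D : Tables) (m : ℕ) (w : ℕ → ℕ) : ℕ → ℕ → ℕ → (ℕ → ℕ) → Prop
  | 0, _, _, _ => True
  | i + 1, h, Q, a => a i = D.dec (i + 1) h Q ∧
    D.Recorded m w i (h - specialInc m (a i)) (Q - w (a i)) a

variable {D : Tables} {m : ℕ} {w : ℕ → ℕ} {C : ℕ → ℕ → ℝ} {n N : ℕ}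

theorem Recorded.congr {i h Q : ℕ} {a b : ℕ → ℕ} (hr : D.Recorded m w i h Q a)
    (hab : ∀ k < i, a k = b k) : D.Recorded m w i h Q b := by
  induction i generalizing h Q with
  | zero => trivial
  | succ i ih =>
    obtain ⟨h1, h2⟩ := hr
    rw [hab i (by omega)] at h1 h2
    exact ⟨h1, ih h2 fun k hk => hab k (by omega)⟩

theorem exists_recorded (D : Tables) (m : ℕ) (w : ℕ → ℕ) (i h Q : ℕ) :
    ∃ a, D.Recorded m w i h Q a := by
  induction i generalizing h Q with
  | zero => exact ⟨0, trivial⟩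
  | succ i ih =>
    obtain ⟨a, ha⟩ := ih (h - specialInc m (D.dec (i + 1) h Q)) (Q - w (D.dec (i + 1) h Q))
    refine ⟨Function.update a i (D.dec (i + 1) h Q), by simp, ?_⟩
    rw [Function.update_self]
    exact ha.congr fun k hk => by rw [Function.update_of_ne hk.ne]

/-- Soundness of the dynamic program: following the stored decisions from a valid entry reproduces
its value. -/
theorem Correct.chain (hD : D.Correct m w C n N) {i h Q : ℕ} {a : ℕ → ℕ}
    (hr : D.Recorded m w i h Q a) (hi : i ≤ n) (hh : h ≤ m) (hQ : Q < N)
    (hv : 1 ≤ D.valid i h Q) :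
    Chain m w i h Q a ∧ D.val i h Q = ∑ k ∈ Finset.range i, C k (a k) := by
  induction i generalizing h Q with
  | zero =>
    obtain ⟨rfl, rfl⟩ := (hD.base h hh Q hQ).1 hv
    exact ⟨⟨rfl, rfl⟩, by simp [hD.base_val]⟩
  | succ i ih =>
    obtain ⟨h1, h2⟩ := hr
    obtain ⟨hs, hv', hval⟩ := (hD.step i hi h hh Q hQ).sound hv
    rw [← h1] at hs hv' hval
    obtain ⟨hc, hval'⟩ := ih h2 (by omega) (by omega) (by omega) hv'
    exact ⟨⟨hs, hc⟩, by rw [hval, hval', Finset.sum_range_succ]⟩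

/-- Optimality, by the Bellman recursion. The types tried are those below `2 * m + 1`; this is
enough since `h ≤ m` bounds the special types by `2 * m`. -/
theorem Correct.val_le (hD : D.Correct m w C n N) {i h Q : ℕ} {a : ℕ → ℕ}
    (hc : Chain m w i h Q a) (hi : i ≤ n) (hh : h ≤ m) (hQ : Q < N) :
    1 ≤ D.valid i h Q ∧ D.val i h Q ≤ ∑ k ∈ Finset.range i, C k (a k) := by
  induction i generalizing h Q with
  | zero =>
    obtain ⟨rfl, rfl⟩ := hc
    exact ⟨(hD.base 0 hh 0 hQ).2 ⟨rfl, rfl⟩, by simp [hD.base_val]⟩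
  | succ i ih =>
    obtain ⟨hs, hc⟩ := hc
    obtain ⟨hv, hval⟩ := ih hc (by omega) (by omega) (by omega)
    obtain ⟨hv', hval'⟩ := (hD.step i hi h hh Q hQ).complete (a i)
      (by rcases hs.1 with h1 | h1 <;> omega) hs hv
    refine ⟨hv', ?_⟩
    rw [Finset.sum_range_succ]
    linarith

end Tables

/-! ### Solutions given by chains -/

/-- The rows of the special facilities, by the names of their entries. -/
abbrev Pattern (m : ℕ) := Fin m → Fin m → Finset (Fin m) × Bool

namespace UniformInstance

variable {m n : ℕ} (I : UniformInstance m n) (π : Pattern m)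

/-- The amounts shipped by a facility of type `r`. -/
noncomputable def row (r j : ℕ) : ℝ :=
  if r ≤ m then if r = j + 1 then I.s else 0
  else if h : r - (m + 1) < m ∧ j < m then I.residue (π ⟨r - (m + 1), h.1⟩ ⟨j, h.2⟩) else 0

/-- The cost of giving type `r` to facility `i`. -/
noncomputable def rowCost (i r : ℕ) : ℝ :=
  (if r = 0 then 0 else I.input .opening i 0) +
    ∑ j ∈ Finset.range m, I.input .service i j * I.row π r j

/-- The sequence `a` of types defines a feasible solution. -/
def ChainFeasible (a : ℕ → ℕ) : Prop :=
  I.IsFeasible (fun i j => I.row π (a i) j) (fun i => used (a i))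

/-- There is a feasible solution with special rows `π`, with `h` special facilities, with total
weight `Q`, and with cost `v`. -/
def Attains (h Q : ℕ) (v : ℝ) : Prop :=
  ∃ a, Chain m (typeWeight m (n + 1)) n h Q a ∧ I.ChainFeasible π a ∧
    ∑ i ∈ Finset.range n, I.rowCost π i (a i) = v

variable {I π}

theorem row_zero (j : ℕ) : I.row π 0 j = 0 := by simp [row]

theorem totalCost_chain (a : ℕ → ℕ) :
    I.totalCost (fun i j => I.row π (a i) j) (fun i => used (a i)) =
      ∑ i ∈ Finset.range n, I.rowCost π i (a i) := by
  rw [← Fin.sum_univ_eq_sum_range (fun i => I.rowCost π i (a i)), totalCost,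
    ← Finset.sum_add_distrib]
  refine Finset.sum_congr rfl fun i _ => ?_
  rw [rowCost, ← Fin.sum_univ_eq_sum_range
    (fun j => I.input .service i j * I.row π (a i) j), add_comm]
  congr 1
  · by_cases h : a i = 0 <;> simp [used, input, h]
  · refine Finset.sum_congr rfl fun j _ => ?_
    simp [input]

/-- Column sums and the number of open facilities are sums over the types, hence determined by `(h,
Q)`. Row constraints hold automatically for types up to `m`, and each special type of `a'` also
occurs in `a`. So one feasibility test settles all chains with these parameters. -/
theorem ChainFeasible.transfer {h Q : ℕ} {a a' : ℕ → ℕ}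
    (hc : Chain m (typeWeight m (n + 1)) n h Q a) (hc' : Chain m (typeWeight m (n + 1)) n h Q a')
    (hf : I.ChainFeasible π a) : I.ChainFeasible π a' := by
  have hrow : ∀ i : Fin n, (∀ j : Fin m, 0 ≤ I.row π (a' i) j) ∧
      ∑ j : Fin m, I.row π (a' i) j ≤ I.s * (used (a' i) : ℝ) := by
    intro i
    rcases hc'.type_cases i.2 with h1 | ⟨t, ht, h1⟩
    · refine ⟨fun j => ?_, ?_⟩
      · simp only [row, h1, if_true]
        split_ifs
        exacts [I.s_pos.le, le_rfl]
      · simp only [row, h1, if_true]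
        by_cases h0 : a' i = 0
        · simp [h0, used]
        · rw [Finset.sum_eq_single (⟨a' i - 1, by omega⟩ : Fin m)]
          · have hu : (used (a' i) : ℝ) = 1 := by simp [used, h0]
            rw [hu, mul_one]
            split_ifs
            exacts [le_rfl, I.s_pos.le]
          · intro j _ hj
            refine if_neg fun h2 => hj (Fin.ext ?_)
            simp only
            omega
          · simp
    · obtain ⟨k, hk, h2⟩ := hc.exists_special ht
      rw [h1, ← h2]
      exact ⟨hf.nonneg ⟨k, hk⟩, hf.capacity ⟨k, hk⟩⟩
  refine ⟨fun j => ?_, fun i => (hrow i).2, ?_, fun i => (hrow i).1, fun i => ?_⟩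
  · rw [← hf.demand j, Fin.sum_univ_eq_sum_range (fun i => I.row π (a' i) j),
      Fin.sum_univ_eq_sum_range (fun i => I.row π (a i) j)]
    exact hc'.sum_congr (F := fun r => I.row π r j) (row_zero _) hc
  · refine le_trans (le_of_eq ?_) hf.cardinality
    rw [Fin.sum_univ_eq_sum_range (fun i => used (a' i)),
      Fin.sum_univ_eq_sum_range (fun i => used (a i))]
    exact hc'.sum_congr (F := used) rfl hc
  · unfold used
    split_ifs <;> simp

/-- Chains with at most `m` special types attain values below that of any feasible solution. -/
theorem exists_attains {x : Fin n → Fin m → ℝ} {y : Fin n → ℕ} (hxy : I.IsFeasible x y) :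
    ∃ π h Q v, h ≤ m ∧ Q < (n + 1) ^ m ∧ I.Attains π h Q v ∧ v ≤ I.totalCost x y := by
  classical
  obtain ⟨z, hz, hzc, hres, T, hTm, hT⟩ := I.exists_structured hxy
  choose e he using hres
  -- `p` marks the special facilities; `Nat.count p i` is the rank of facility `i` among them.
  set p : ℕ → Prop := fun i => ∃ h : i < n, z ⟨i, h⟩ ≠ 0 ∧ ∀ j, z ⟨i, h⟩ ≠ Pi.single j I.s with hp
  have hcount : Nat.count p n ≤ m := by
    refine le_trans ?_ hTm
    rw [Nat.count_eq_card_filter_range]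
    refine le_trans (Finset.card_le_card ?_) (Finset.card_map Fin.valEmbedding).le
    intro i hi
    obtain ⟨-, hin, h0, h1⟩ := Finset.mem_filter.1 hi
    refine Finset.mem_map.2 ⟨⟨i, hin⟩, ?_, rfl⟩
    by_contra hiT
    rcases hT _ hiT with h2 | ⟨j, h2⟩
    exacts [h0 h2, h1 j h2]
  have hlt : ∀ i, p i → Nat.count p i < m := fun i hi =>
    lt_of_lt_of_le (Nat.count_strict_mono hi hi.1) hcount
  -- Ranks that do not occur get the default name `(∅, false)`; no type of the chain refers to them.
  set π : Pattern m := fun t j =>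
    if h : ∃ i : Fin n, p i ∧ Nat.count p i = t then e h.choose j else (∅, false) with hπ
  set a : ℕ → ℕ := fun i =>
    if p i then m + 1 + Nat.count p i
    else if h : ∃ (h : i < n) (j : Fin m), z ⟨i, h⟩ = Pi.single j I.s
      then (h.choose_spec.choose : ℕ) + 1 else 0 with ha
  have hπa : ∀ i : Fin n, p i → ∀ j (h : Nat.count p i < m),
      π ⟨Nat.count p i, h⟩ j = e i j := by
    intro i hi j h
    have hex : ∃ i' : Fin n, p i' ∧ Nat.count p i' = Nat.count p i := ⟨i, hi, rfl⟩
    simp only [hπ]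
    rw [dif_pos hex]
    congr 1
    exact Fin.ext (Nat.count_injective hex.choose_spec.1 hi hex.choose_spec.2)
  have hrow : ∀ (i : Fin n) (j : Fin m), I.row π (a i) j = z i j := by
    intro i j
    by_cases hi : p i
    · have h1 : a i = m + 1 + Nat.count p i := by simp [ha, hi]
      rw [row, if_neg (by omega), he]
      have h2 := hlt i hi
      simp only [h1, Nat.add_sub_cancel_left]
      rw [dif_pos ⟨h2, j.2⟩, hπa i hi j h2]
    · by_cases h : ∃ (h : (i : ℕ) < n) (j : Fin m), z ⟨i, h⟩ = Pi.single j I.s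
      · have h1 : a i = (h.choose_spec.choose : ℕ) + 1 := by simp only [ha]; rw [if_neg hi, dif_pos h]
        obtain ⟨j₀, h1, h2⟩ : ∃ j₀ : Fin m, a i = j₀ + 1 ∧ z i = Pi.single j₀ I.s :=
          ⟨_, h1, h.choose_spec.choose_spec⟩
        rw [row, if_pos (by omega), h1, h2]
        by_cases hj : j = j₀
        · rw [← hj]; simp
        · rw [Pi.single_eq_of_ne hj, if_neg]
          exact fun h3 => hj (Fin.ext (by omega))
      · have h1 : a i = 0 := by simp only [ha]; rw [if_neg hi, dif_neg h]
        rw [h1, row_zero]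
        by_contra hne
        refine hi ⟨i.2, fun h0 => hne ?_, fun j' hj' => h ⟨i.2, j', hj'⟩⟩
        have : z i = 0 := h0
        simp [this]
  have hai : ∀ k, ¬ p k → a k ≤ m := by
    intro k hk
    simp only [ha]
    rw [if_neg hk]
    split_ifs with h
    · omega
    · omega
  have hinc : ∀ k, specialInc m (a k) = if p k then 1 else 0 := by
    intro k
    split_ifs with hk
    · exact specialInc_of_lt (by simp only [ha]; rw [if_pos hk]; omega)
    · exact specialInc_of_le (hai k hk)
  have hsum : ∀ k, ∑ l ∈ Finset.range k, specialInc m (a l) = Nat.count p k := by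
    intro k
    rw [Nat.count_eq_card_filter_range, Finset.card_filter]
    exact Finset.sum_congr rfl fun l _ => hinc l
  have hchain := Chain.of_forall (w := typeWeight m (n + 1)) (m := m) (n := n) (a := a) fun k _ => by
    rw [hsum]
    by_cases hk : p k
    · right; simp [ha, hk]
    · exact Or.inl (hai k hk)
  rw [hsum] at hchain
  -- The chain closes facilities that are open in `y` but ship nothing. This keeps feasibility and,
  -- as opening costs are nonnegative, does not raise the cost.
  have hused : ∀ i : Fin n, used (a i) ≤ y i ∧ (used (a i) = 0 → z i = 0) := by
    intro i
    by_cases h0 : a i = 0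
    · refine ⟨by simp [used, h0], fun _ => funext fun j => ?_⟩
      rw [← hrow, h0, row_zero]; rfl
    · refine ⟨?_, fun h => by simp [used, h0] at h⟩
      rcases hz.binary i with hy | hy
      · exfalso
        have hcap := hz.capacity i
        rw [hy, Nat.cast_zero, mul_zero] at hcap
        have hz0 : z i = 0 := by
          funext j
          exact (Finset.sum_eq_zero_iff_of_nonneg (fun j _ => hz.nonneg i j)).1
            (le_antisymm hcap (Finset.sum_nonneg fun j _ => hz.nonneg i j)) j (Finset.mem_univ j)
        have hi : ¬ p i := fun ⟨_, h1, _⟩ => h1 hz0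
        have : ¬ ∃ (h : (i : ℕ) < n) (j : Fin m), z ⟨i, h⟩ = Pi.single j I.s := by
          rintro ⟨_, j, hj⟩
          have := congrFun (hz0.symm.trans hj) j
          simp at this
          exact I.s_pos.ne this
        exact h0 (by simp only [ha]; rw [if_neg hi, dif_neg this])
      · rw [hy, used]; split_ifs; omega
  have hfeas : I.ChainFeasible π a := by
    refine ⟨fun j => ?_, fun i => ?_, ?_, fun i j => ?_, fun i => ?_⟩
    · simp only [hrow]; exact hz.demand j
    · simp only [hrow]
      by_cases h0 : used (a i) = 0
      · simp [(hused i).2 h0, h0]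
      · refine (hz.capacity i).trans (mul_le_mul_of_nonneg_left ?_ I.s_pos.le)
        have h1 : y i ≤ 1 := by rcases hz.binary i with h | h <;> omega
        exact_mod_cast h1.trans (Nat.one_le_iff_ne_zero.2 h0)
    · exact (Finset.sum_le_sum fun i _ => (hused i).1).trans hz.cardinality
    · simp only [hrow]; exact hz.nonneg i j
    · unfold used; split_ifs <;> simp
  refine ⟨π, _, _, _, hcount, hchain.weight_lt, ⟨a, hchain, hfeas, rfl⟩, ?_⟩
  rw [← totalCost_chain]
  refine le_trans ?_ hzc
  simp only [totalCost, hrow]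
  gcongr with i _
  · exact I.f_nonneg i
  · exact (hused i).1

end UniformInstance

/-! ### The program

Arrays of natural numbers: `0` input, `1` flag, `2` output, `3` weights of the types, `4` validity
and `5` decisions of the dynamic program, `6` candidate, `7` acceptance of the candidate, `8` number
of open facilities, `9` and `10` position in the tables, `11` number of total weights, `12` and `13`
auxiliary scalars, from `20` on loop counters. Arrays of real numbers: `0` output, `1` rows of the
types, `2` costs of the types, `3` values of the dynamic program, `4` candidate, `6` cost of the
output, `7` accumulator. -/

namespace Program

open NExp (var)

/-- `w r := B ^ (r - 1)` for `1 ≤ r ≤ m`, and the scalar `11` becomes `B ^ m`, where `B` is the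
number of facilities plus one. -/
def powers (m : ℕ) : Program :=
  .seq (setVar 11 (.const 1))
    (forLoop 20 (.const m)
      (.seq (.assignNat 3 (.add (var 20) (.const 1)) (.const 0) (var 11))
        (.seq (setVar 12 (var 11))
          (forLoop 21 (var 0) (setVar 11 (.add (var 11) (var 12)))))))

/-- The total demand of a list of clients. -/
def demandSum {m : ℕ} (l : List (Fin m)) : RExp :=
  l.foldr (fun (k : Fin m) e => .add (.input .demand (.const k) (.const 0)) e) .zero

/-- Reduce entry `(r, j)` of the array of rows modulo the capacity. -/
def reduceLoop (r j : ℕ) : Program :=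
  forLoop 20 (var 0)
    (.cond (.realLE (.input .capacity (.const 0) (.const 0)) (.get 1 (.const r) (.const j)))
      (.assignReal 1 (.const r) (.const j)
        (.sub (.get 1 (.const r) (.const j)) (.input .capacity (.const 0) (.const 0))))
      .skip)

/-- Entry `(r, j)` of the array of rows. -/
noncomputable def fillEntry {m : ℕ} (π : Pattern m) (r j : ℕ) : Program :=
  if r ≤ m then
    .assignReal 1 (.const r) (.const j)
      (if r = j + 1 then .input .capacity (.const 0) (.const 0) else .zero)
  else if h : r - (m + 1) < m ∧ j < m then
    .seq (.assignReal 1 (.const r) (.const j)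
        (demandSum (π ⟨r - (m + 1), h.1⟩ ⟨j, h.2⟩).1.toList))
      (.seq (reduceLoop r j)
        (if (π ⟨r - (m + 1), h.1⟩ ⟨j, h.2⟩).2 then
          .assignReal 1 (.const r) (.const j)
            (.sub (.input .capacity (.const 0) (.const 0)) (.get 1 (.const r) (.const j)))
        else .skip))
  else .assignReal 1 (.const r) (.const j) .zero

/-- The array of rows. -/
noncomputable def fillRows {m : ℕ} (π : Pattern m) : Program :=
  seqList (((List.range (2 * m + 1)).product (List.range m)).map fun q => fillEntry π q.1 q.2)

/-- The array of the costs of all types for all facilities. -/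
def costs (m : ℕ) : Program :=
  forLoop 20 (var 0) (forLoop 21 (.const (2 * m + 1))
    (.seq
      (.cond (.natLE (var 21) (.const 0))
        (.assignReal 2 (var 20) (var 21) .zero)
        (.assignReal 2 (var 20) (var 21) (.input .opening (var 20) (.const 0))))
      (forLoop 22 (.const m)
        (.assignReal 2 (var 20) (var 21)
          (.add (.get 2 (var 20) (var 21))
            (.mulInput .service (var 20) (var 22) (.get 1 (var 21) (var 22))))))))

/-- The address of the entries `(i, h)` of the tables. -/
def address (m : ℕ) (i h : NExp) : NExp := .add (.mulConst (m + 1) i) h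

/-- `1` for special types, `0` for others. -/
def incExp (m : ℕ) (r : NExp) : NExp := .sub (.const 1) (.sub (.const 1) (.sub r (.const m)))

/-- The address of the predecessor of the entry `(20 + 1, 21, 22)` with last type `23`. -/
def predAddress (m : ℕ) : NExp := address m (var 20) (.sub (var 21) (incExp m (var 23)))

/-- The total weight of that predecessor. -/
def predWeight : NExp := .sub (var 22) (.get 3 (var 23) (.const 0))

/-- The type `23` is admissible for the entry `(20 + 1, 21, 22)` and its predecessor is valid. -/
def relaxTest (m : ℕ) : Test :=
  .both
    (.both
      (.neg (.both (.neg (.natLE (var 23) (.const m)))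
        (.neg (.both (.natLE (var 23) (.add (.const m) (var 21)))
          (.natLE (.add (.const m) (var 21)) (var 23))))))
      (.natLE (.get 3 (var 23) (.const 0)) (var 22)))
    (.natLE (.const 1) (.get 4 (predAddress m) predWeight))

/-- The cost of reaching the entry through the type `23`. -/
def relaxValue (m : ℕ) : RExp := .add (.get 3 (predAddress m) predWeight) (.get 2 (var 20) (var 23))

/-- The address of the entries `(20 + 1, 21)`. -/
def cellAddress (m : ℕ) : NExp := address m (.add (var 20) (.const 1)) (var 21)

/-- Improve the entry `(20 + 1, 21, 22)` through the type `23`. -/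
def relax (m : ℕ) : Program :=
  .cond (relaxTest m)
    (.cond (.neg (.both (.natLE (.const 1) (.get 4 (cellAddress m) (var 22)))
        (.neg (.realLE (relaxValue m) (.get 3 (cellAddress m) (var 22))))))
      (.seq (.assignNat 4 (cellAddress m) (var 22) (.const 1))
        (.seq (.assignReal 3 (cellAddress m) (var 22) (relaxValue m))
          (.assignNat 5 (cellAddress m) (var 22) (var 23))))
      .skip)
    .skip

/-- Compute the entry `(20 + 1, 21, 22)`. -/
def cell (m : ℕ) : Program :=
  .seq (.assignNat 4 (cellAddress m) (var 22) (.const 0))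
    (forLoop 23 (.const (2 * m + 1)) (relax m))

/-- The entries `(0, h, Q)`. -/
def tableBase (m : ℕ) : Program :=
  .seq (forLoop 21 (.const (m + 1)) (forLoop 22 (var 11)
      (.assignNat 4 (var 21) (var 22) (.const 0))))
    (.seq (.assignNat 4 (.const 0) (.const 0) (.const 1))
      (.assignReal 3 (.const 0) (.const 0) .zero))

/-- The entries `(i, h, Q)` with `i ≥ 1`. -/
def tableStep (m : ℕ) : Program :=
  forLoop 20 (var 0) (forLoop 21 (.const (m + 1)) (forLoop 22 (var 11) (cell m)))

/-- Read off the candidate with the parameters `20` and `21`. -/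
def backtrack (m : ℕ) : Program :=
  .seq (setVar 9 (var 20)) (.seq (setVar 10 (var 21))
    (forLoop 22 (var 0)
      (.seq (setVar 13 (.get 5 (address m (.sub (var 0) (var 22)) (var 9)) (var 10)))
        (.seq (.assignNat 6 (.sub (.sub (var 0) (var 22)) (.const 1)) (.const 0)
            (.sub (.const 1) (.sub (.const 1) (var 13))))
          (.seq (forLoop 23 (.const m)
              (.assignReal 4 (.sub (.sub (var 0) (var 22)) (.const 1)) (var 23)
                (.get 1 (var 13) (var 23))))
            (.seq (setVar 9 (.sub (var 9) (incExp m (var 13))))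
              (setVar 10 (.sub (var 10) (.get 3 (var 13) (.const 0))))))))))

/-- Reject the candidate unless `b` holds. -/
def require (b : Test) : Program := .cond b .skip (setVar 7 (.const 0))

/-- Check nonnegativity and capacity, and count the open facilities. -/
def checkRows (m : ℕ) : Program :=
  .seq (setVar 7 (.const 1)) (.seq (setVar 8 (.const 0))
    (forLoop 22 (var 0)
      (.seq (setVar 8 (.add (var 8) (.get 6 (var 22) (.const 0))))
        (.seq (setRealVar 7 .zero)
          (.seq (forLoop 23 (.const m)
              (.seq (setRealVar 7 (.add (.var 7) (.get 4 (var 22) (var 23))))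
                (require (.realLE .zero (.get 4 (var 22) (var 23))))))
            (.cond (.natLE (.const 1) (.get 6 (var 22) (.const 0)))
              (require (.realLE (.var 7) (.input .capacity (.const 0) (.const 0))))
              (require (.realLE (.var 7) .zero))))))))

/-- Check the demands. -/
def checkColumns (m : ℕ) : Program :=
  forLoop 23 (.const m)
    (.seq (setRealVar 7 .zero)
      (.seq (forLoop 22 (var 0) (setRealVar 7 (.add (.var 7) (.get 4 (var 22) (var 23)))))
        (require (.both (.realLE (.var 7) (.input .demand (var 23) (.const 0)))
          (.realLE (.input .demand (var 23) (.const 0)) (.var 7))))))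

/-- Check the feasibility of the candidate. -/
def check (m : ℕ) : Program :=
  .seq (checkRows m) (.seq (checkColumns m)
    (require (.natLE (var 8) (.get 0 (.const 0) (.const 1)))))

/-- The cost of the candidate with the parameters `20` and `21`. -/
def candidateCost (m : ℕ) : RExp := .get 3 (address m (var 0) (var 20)) (var 21)

/-- Replace the output by the candidate if that is feasible and not more expensive. -/
def update (m : ℕ) : Program :=
  .cond (.both (.natLE (.const 1) (var 7))
      (.neg (.both (.natLE (.const 1) (var 1)) (.neg (.realLE (candidateCost m) (.var 6))))))
    (.seq (setVar 1 (.const 1))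
      (.seq (setRealVar 6 (candidateCost m))
        (forLoop 22 (var 0)
          (.seq (.assignNat 2 (var 22) (.const 0) (.get 6 (var 22) (.const 0)))
            (forLoop 23 (.const m)
              (.assignReal 0 (var 22) (var 23) (.get 4 (var 22) (var 23))))))))
    .skip

/-- Try all candidates in the tables. -/
def scan (m : ℕ) : Program :=
  forLoop 20 (.const (m + 1)) (forLoop 21 (var 11)
    (.cond (.natLE (.const 1) (.get 4 (address m (var 0) (var 20)) (var 21)))
      (.seq (backtrack m) (.seq (check m) (update m)))
      .skip))

/-- Try all solutions with special rows `π`. -/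
noncomputable def attempt {m : ℕ} (π : Pattern m) : Program :=
  .seq (fillRows π) (.seq (costs m) (.seq (tableBase m) (.seq (tableStep m) (scan m))))

/-- The whole program. -/
noncomputable def solver (m : ℕ) : Program :=
  .seq (powers m) (seqList ((Finset.univ : Finset (Pattern m)).toList.map attempt))

end Program

open Program

/-! ### Weights, rows and costs -/

@[simp] theorem Store.setNat_nat (σ : Store) (a p q v a' p' q' : ℕ) :
    (σ.setNat a p q v).nat a' p' q' = if a' = a ∧ p' = p ∧ q' = q then v else σ.nat a' p' q' := rfl

@[simp] theorem Store.setNat_real (σ : Store) (a p q v : ℕ) :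
    (σ.setNat a p q v).real = σ.real := rfl

@[simp] theorem Store.setReal_real (σ : Store) (a p q : ℕ) (v : ℝ) (a' p' q' : ℕ) :
    (σ.setReal a p q v).real a' p' q' =
      if a' = a ∧ p' = p ∧ q' = q then v else σ.real a' p' q' := rfl

@[simp] theorem Store.setReal_nat (σ : Store) (a p q : ℕ) (v : ℝ) :
    (σ.setReal a p q v).nat = σ.nat := rfl

attribute [simp] NExp.eval RExp.eval

theorem powers_spec {inp : Input} {m n : ℕ} {σ : Store} (hn : σ.nat 0 0 0 = n)
    (h3 : ∀ r, σ.nat 3 r 0 = 0) :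
    Runs inp (powers m) σ ((n + 1) * (m + 1)) (fun τ => τ.nat 11 0 0 = (n + 1) ^ m ∧
      ∀ r, τ.nat 3 r 0 = typeWeight m (n + 1) r) := by
  refine Runs.comp (Runs.setVar (Nat.succ_le_of_lt (by positivity)) ?_)
  refine (Runs.forLoop (N := m) (X := n + 1) (fun i τ => τ.nat 11 0 0 = (n + 1) ^ i ∧
      ∀ r, τ.nat 3 r 0 = typeWeight i (n + 1) r) (Nat.succ_le_of_lt (by positivity)) rfl (fun _ _ => rfl)
      (fun i τ v h => by simpa using h) ?_ ?_)
  · refine ⟨by simp, fun r => ?_⟩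
    have : ¬ (1 ≤ r ∧ r ≤ 0) := by omega
    rw [typeWeight, if_neg this]
    simp [h3]
  · rintro i hi τ hF hτ ⟨h11, hw⟩
    have hn' : τ.nat 0 0 0 = n := by rw [hF.nat 0 rfl]; simpa using hn
    refine Runs.comp (Runs.assignNat (Nat.succ_le_of_lt (by positivity)) ?_)
    refine Runs.comp (Runs.setVar (Nat.succ_le_of_lt (by positivity)) ?_)
    -- Multiplication by `n + 1` is done by `n` additions, since natural numbers cannot be
    -- multiplied.
    refine ((Runs.forLoop (N := n) (X := 1) (fun k ρ => ρ.nat 11 0 0 = (k + 1) * (n + 1) ^ i)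
      le_rfl rfl (fun ρ hρ => ?_) (fun i τ v h => by simpa using h) ?_ ?_).mono (by omega)).imp ?_
    · rw [NExp.eval_var, hρ.nat 0 rfl]; simpa using hn'
    · simpa using h11
    · intro k hk ρ hρ _ h
      refine Runs.setVar le_rfl ?_
      have h12 : ρ.nat 12 0 0 = (n + 1) ^ i := by rw [hρ.nat 12 rfl]; simpa using h11
      simp [h, h12]; ring
    · intro ρ hρ h
      refine ⟨by rw [h, pow_succ]; ring, fun r => ?_⟩
      rw [hρ.nat 3 rfl]
      simp only [Store.setNat_nat, NExp.eval, NExp.eval_var, hτ, h11]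
      simp only [hw, typeWeight]
      by_cases hr : r = i + 1
      · subst hr; simp
      · have : (1 ≤ r ∧ r ≤ i + 1) ↔ (1 ≤ r ∧ r ≤ i) := by omega
        simp [hr, this]

theorem eval_demandSum {m n : ℕ} (I : UniformInstance m n) (σ : Store) (K : Finset (Fin m)) :
    (demandSum K.toList).eval I.input σ = ∑ k ∈ K, I.d k := by
  rw [← Finset.sum_map_toList]
  induction K.toList with
  | nil => simp [demandSum]
  | cons k l ih =>
    simp only [demandSum, List.foldr_cons, List.map_cons, List.sum_cons, RExp.eval] at ih ⊢
    rw [ih]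
    simp [UniformInstance.input]

section

variable {m n : ℕ} {I : UniformInstance m n} {π : Pattern m}

theorem reduceLoop_spec {σ : Store} (hn : σ.nat 0 0 0 = n) (r j : ℕ) :
    Runs I.input (reduceLoop r j) σ (n + 1) (fun τ =>
      τ.real 1 r j = (reduce I.s)^[n] (σ.real 1 r j) ∧
      ∀ p q, ¬ (p = r ∧ q = j) → τ.real 1 p q = σ.real 1 p q) := by
  refine (Runs.forLoop (N := n) (X := 1) (fun k ρ =>
    ρ.real 1 r j = (reduce I.s)^[k] (σ.real 1 r j) ∧
    ∀ p q, ¬ (p = r ∧ q = j) → ρ.real 1 p q = σ.real 1 p q)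
    le_rfl rfl (fun ρ hρ => ?_) (fun i τ v h => by simpa using h) (by simp) ?_).mono (by omega)
  · rw [NExp.eval_var, hρ.nat 0 rfl, hn]
  · rintro k hk ρ hρ - ⟨hv, ho⟩
    refine Runs.cond le_rfl (fun hT => Runs.assignReal le_rfl ?_) (fun hT => Runs.skip le_rfl ?_)
    · simp only [Test.Holds, RExp.eval, NExp.eval, UniformInstance.input] at hT
      rw [Function.iterate_succ_apply', ← hv, reduce, if_pos hT]
      simp +contextual [UniformInstance.input, ho]
    · simp only [Test.Holds, RExp.eval, NExp.eval, UniformInstance.input] at hT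
      rw [Function.iterate_succ_apply', ← hv, reduce, if_neg hT]
      exact ⟨rfl, ho⟩

theorem fillEntry_spec {σ : Store} (hn : σ.nat 0 0 0 = n) (r j : ℕ) :
    Runs I.input (fillEntry π r j) σ (n + 1) (fun τ => τ.real 1 r j = I.row π r j ∧
      ∀ p q, ¬ (p = r ∧ q = j) → τ.real 1 p q = σ.real 1 p q) := by
  unfold fillEntry UniformInstance.row
  by_cases h1 : r ≤ m
  · rw [if_pos h1, if_pos h1]
    split_ifs
    · exact Runs.assignReal (by omega) (by simp +contextual [UniformInstance.input])
    · exact Runs.assignReal (by omega) (by simp +contextual)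
  rw [if_neg h1, if_neg h1]
  by_cases h2 : r - (m + 1) < m ∧ j < m
  · rw [dif_pos h2, dif_pos h2]
    refine Runs.comp (Runs.assignReal (by omega) ?_)
    refine Runs.comp ((reduceLoop_spec (by simpa using hn) r j).imp ?_)
    simp only [NExp.eval, eval_demandSum, Store.setReal_real, and_self, if_true]
    rintro ρ hρ ⟨hv, ho⟩
    have ho' : ∀ p q, ¬ (p = r ∧ q = j) → ρ.real 1 p q = σ.real 1 p q := fun p q h => by
      rw [ho p q h, if_neg (by simpa using h)]
    split_ifs with h3
    · refine Runs.assignReal (by omega) ?_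
      simp +contextual [UniformInstance.input, UniformInstance.residue, h3, hv, ho']
    · exact Runs.skip (by omega) ⟨by simp [UniformInstance.residue, h3, hv], ho'⟩
  · rw [dif_neg h2, dif_neg h2]
    exact Runs.assignReal (by omega) (by simp +contextual)

/-- The program text depends on `m` and `π` through an unrolled list, so here the frame does not
follow by computation. -/
theorem writesNat_fillRows {a : ℕ} (ha : a ≠ 20) : (fillRows π).writesNat a = false := by
  refine writesNat_seqList fun P hP => ?_
  obtain ⟨q, -, rfl⟩ := List.mem_map.1 hP
  unfold fillEntry
  split_ifs <;> simp [writesNat, reduceLoop, forLoop, setVar, ha.symm]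

theorem writesReal_fillRows {a : ℕ} (ha : a ≠ 1) : (fillRows π).writesReal a = false := by
  refine writesReal_seqList fun P hP => ?_
  obtain ⟨q, -, rfl⟩ := List.mem_map.1 hP
  unfold fillEntry
  split_ifs <;> simp [writesReal, reduceLoop, forLoop, setVar, ha.symm]

theorem fillRows_spec {σ : Store} (hn : σ.nat 0 0 0 = n) :
    Runs I.input (fillRows π) σ (n + 1) (fun τ => ∀ r < 2 * m + 1, ∀ j < m,
      τ.real 1 r j = I.row π r j) := by
  refine (Runs.seqList (fun q : ℕ × ℕ => fillEntry π q.1 q.2)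
    (fun S τ => ∀ q ∈ S, τ.real 1 q.1 q.2 = I.row π q.1 q.2) (by omega) _ ?_ (by simp)).imp ?_
  · intro S q _ τ hF hS
    have hn' : τ.nat 0 0 0 = n := by
      rw [hF.nat 0 (writesNat_fillRows (π := π) (by norm_num)), hn]
    refine (fillEntry_spec hn' q.1 q.2).imp fun ρ _ hρ => ?_
    rintro q' hq'
    by_cases h : q'.1 = q.1 ∧ q'.2 = q.2
    · rw [h.1, h.2]; exact hρ.1
    · rw [hρ.2 _ _ h]
      refine hS q' (hq'.resolve_left fun h' => h (by simp [h']))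
  · intro τ _ h r hr j hj
    exact h (r, j) (List.mem_product.2 ⟨List.mem_range.2 hr, List.mem_range.2 hj⟩)

theorem costs_spec {σ : Store} (hn : σ.nat 0 0 0 = n)
    (hR : ∀ r < 2 * m + 1, ∀ j < m, σ.real 1 r j = I.row π r j) :
    Runs I.input (costs m) σ ((m + 1) * (2 * m + 2) * (n + 1)) (fun τ => ∀ i < n,
      ∀ r < 2 * m + 1, τ.real 2 i r = I.rowCost π i r) := by
  refine Runs.forLoop (N := n) (fun i τ => ∀ i' < i, ∀ r < 2 * m + 1,
    τ.real 2 i' r = I.rowCost π i' r) (Nat.succ_le_of_lt (by positivity)) rfl (fun ρ hρ => ?_) (fun i τ v h => h)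
    (by simp) ?_
  · rw [NExp.eval_var, hρ.nat 0 rfl, hn]
  intro i hi τ hF hτ hI
  refine (Runs.forLoop (N := 2 * m + 1) (fun r ρ => (∀ i' < i, ∀ r < 2 * m + 1,
    ρ.real 2 i' r = I.rowCost π i' r) ∧ ∀ r' < r, ρ.real 2 i r' = I.rowCost π i r')
    (Nat.succ_le_of_lt (by positivity)) rfl (fun _ _ => rfl) (fun i τ v h => h) ⟨hI, by simp⟩ ?_).imp ?_
  · rintro r hr ρ hFρ hρ ⟨h1, h2⟩
    have h20 : ρ.nat 20 0 0 = i := by rw [hFρ.nat 20 rfl, hτ]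
    refine Runs.seq (Φ := fun τ => τ.real 2 i r = (if r = 0 then 0 else I.input .opening i 0) ∧
      ∀ p q, ¬ (p = i ∧ q = r) → τ.real 2 p q = ρ.real 2 p q)
      (Runs.cond (Nat.succ_le_of_lt (by positivity)) (fun h => Runs.assignReal (Nat.succ_le_of_lt (by positivity)) ?_)
        (fun h => Runs.assignReal (Nat.succ_le_of_lt (by positivity)) ?_)) ?_
    · simp [Test.Holds, hρ] at h
      simp +contextual [h20, hρ, h]
    · simp [Test.Holds, hρ] at h
      simp +contextual [h20, hρ, h]
    rintro ρ₁ hF₁ ⟨hv, ho⟩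
    refine ((Runs.forLoop (N := m) (X := 1) (fun j ρ₂ => ρ₂.real 2 i r =
      (if r = 0 then 0 else I.input .opening i 0) +
        ∑ j ∈ Finset.range j, I.input .service i j * I.row π r j ∧
      ∀ p q, ¬ (p = i ∧ q = r) → ρ₂.real 2 p q = ρ.real 2 p q) le_rfl rfl (fun _ _ => rfl)
      (fun i τ v h => h) ⟨by simp [hv], ho⟩ ?_).mono (by omega)).imp ?_
    · rintro j hj ρ₂ hF₂ h22 ⟨hv₂, ho₂⟩
      have h20' : ρ₂.nat 20 0 0 = i := by rw [hF₂.nat 20 rfl, hF₁.nat 20 rfl, h20]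
      have h21' : ρ₂.nat 21 0 0 = r := by rw [hF₂.nat 21 rfl, hF₁.nat 21 rfl, hρ]
      have hR' : ρ₂.real 1 r j = I.row π r j := by
        rw [hF₂.real 1 rfl, hF₁.real 1 rfl, hFρ.real 1 rfl, hF.real 1 rfl, hR r hr j hj]
      refine Runs.assignReal le_rfl ⟨?_, ?_⟩
      · simp [h20', h21', h22, hR', hv₂, Finset.sum_range_succ, add_assoc]
      · intro p q hpq
        simp [h20', h21', hpq, ho₂ p q hpq]
    · rintro ρ₂ - ⟨hv₂, ho₂⟩
      refine ⟨fun i' hi' r' hr' => ?_, fun r' hr' => ?_⟩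
      · rw [ho₂ _ _ (by omega), h1 i' hi' r' hr']
      · rcases Nat.lt_succ_iff_lt_or_eq.1 hr' with h | rfl
        · rw [ho₂ _ _ (by omega), h2 r' h]
        · exact hv₂
  · rintro ρ - ⟨h1, h2⟩ i' hi' r hr
    rcases Nat.lt_succ_iff_lt_or_eq.1 hi' with h | rfl
    · exact h1 i' h r hr
    · exact h2 r hr

end

/-! ### The tables -/

namespace Tables

variable {D D' : Tables} {m : ℕ} {w : ℕ → ℕ} {C : ℕ → ℕ → ℝ} {R i h Q : ℕ}

/-- Correctness of an entry involves only that entry and those of the previous layer with parameters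
at most `h` and `Q`. -/
theorem CellCorrect.congr (hD : D.CellCorrect m w C R i h Q)
    (hv : ∀ h' ≤ h, ∀ Q' ≤ Q, D'.valid i h' Q' = D.valid i h' Q' ∧ D'.val i h' Q' = D.val i h' Q')
    (hc : D'.valid (i + 1) h Q = D.valid (i + 1) h Q ∧ D'.val (i + 1) h Q = D.val (i + 1) h Q ∧
      D'.dec (i + 1) h Q = D.dec (i + 1) h Q) :
    D'.CellCorrect m w C R i h Q := by
  obtain ⟨h1, h2, h3⟩ := hc
  have e1 : ∀ r, D'.valid i (h - specialInc m r) (Q - w r) = D.valid i (h - specialInc m r) (Q - w r)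
    := fun r => (hv _ (Nat.sub_le _ _) _ (Nat.sub_le _ _)).1
  have e2 : ∀ r, D'.val i (h - specialInc m r) (Q - w r) = D.val i (h - specialInc m r) (Q - w r)
    := fun r => (hv _ (Nat.sub_le _ _) _ (Nat.sub_le _ _)).2
  constructor
  · rw [h1, h2, h3, e1, e2]; exact hD.sound
  · simp only [h1, h2, e1, e2]; exact hD.complete

theorem CellCorrect.succ_of_not (hD : D.CellCorrect m w C R i h Q)
    (h' : Step m w h Q R → 1 ≤ D.valid i (h - specialInc m R) (Q - w R) →
      1 ≤ D.valid (i + 1) h Q ∧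
        D.val (i + 1) h Q ≤ D.val i (h - specialInc m R) (Q - w R) + C i R) :
    D.CellCorrect m w C (R + 1) i h Q := by
  refine ⟨hD.sound, fun r hr hs hv => ?_⟩
  rcases Nat.lt_succ_iff_lt_or_eq.1 hr with hr | rfl
  exacts [hD.complete r hr hs hv, h' hs hv]

theorem CellCorrect.succ_of_improved (hD : D.CellCorrect m w C R i h Q)
    (hv : ∀ h' ≤ h, ∀ Q' ≤ Q, D'.valid i h' Q' = D.valid i h' Q' ∧ D'.val i h' Q' = D.val i h' Q')
    (hs : Step m w h Q R) (hp : 1 ≤ D.valid i (h - specialInc m R) (Q - w R))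
    (himp : 1 ≤ D.valid (i + 1) h Q →
      D.val i (h - specialInc m R) (Q - w R) + C i R ≤ D.val (i + 1) h Q)
    (h1 : D'.valid (i + 1) h Q = 1)
    (h2 : D'.val (i + 1) h Q = D.val i (h - specialInc m R) (Q - w R) + C i R)
    (h3 : D'.dec (i + 1) h Q = R) : D'.CellCorrect m w C (R + 1) i h Q := by
  have e1 : ∀ r, D'.valid i (h - specialInc m r) (Q - w r) = D.valid i (h - specialInc m r) (Q - w r)
    := fun r => (hv _ (Nat.sub_le _ _) _ (Nat.sub_le _ _)).1
  have e2 : ∀ r, D'.val i (h - specialInc m r) (Q - w r) = D.val i (h - specialInc m r) (Q - w r)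
    := fun r => (hv _ (Nat.sub_le _ _) _ (Nat.sub_le _ _)).2
  constructor
  · intro _
    rw [h3, h2, e1, e2]
    exact ⟨hs, hp, rfl⟩
  · intro r hr hsr hvr
    rw [e1] at hvr
    rw [h1, h2, e2]
    refine ⟨le_rfl, ?_⟩
    rcases Nat.lt_succ_iff_lt_or_eq.1 hr with hr | rfl
    · obtain ⟨h4, h5⟩ := hD.complete r hr hsr hvr
      exact (himp h4).trans h5
    · exact le_rfl

end Tables

/-- The tables in the memory. -/
def Store.tables (σ : Store) (m : ℕ) : Tables where
  valid := fun i h Q => σ.nat 4 ((m + 1) * i + h) Q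
  val := fun i h Q => σ.real 3 ((m + 1) * i + h) Q
  dec := fun i h Q => σ.nat 5 ((m + 1) * i + h) Q

theorem Store.tables_setNat {σ : Store} {m a p q v : ℕ} (h4 : 4 ≠ a) (h5 : 5 ≠ a) :
    (σ.setNat a p q v).tables m = σ.tables m := by
  simp [Store.tables, h4, h5]

theorem Store.tables_congr {σ τ : Store} {m : ℕ} (h4 : τ.nat 4 = σ.nat 4)
    (h3 : τ.real 3 = σ.real 3) (h5 : τ.nat 5 = σ.nat 5) : τ.tables m = σ.tables m := by
  simp [Store.tables, h3, h4, h5]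

/-- The tables in `σ` and `τ` agree outside the address `(p, q)`. -/
def AgreeOff (p q : ℕ) (σ τ : Store) : Prop :=
  ∀ p' q', ¬ (p' = p ∧ q' = q) → τ.nat 4 p' q' = σ.nat 4 p' q' ∧
    τ.real 3 p' q' = σ.real 3 p' q' ∧ τ.nat 5 p' q' = σ.nat 5 p' q'

/-- The pair `(i, h)` is packed into one index in base `m + 1`; for `h ≤ m` different layers cannot
collide. -/
theorem address_lt {m i i' h h' : ℕ} (hi : i < i') (hh : h ≤ m) :
    (m + 1) * i + h < (m + 1) * i' + h' := by
  have : (m + 1) * (i + 1) ≤ (m + 1) * i' := Nat.mul_le_mul_left _ hi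
  rw [Nat.mul_succ] at this
  omega

@[simp] theorem eval_address (σ : Store) (m : ℕ) (i h : NExp) :
    (address m i h).eval σ = (m + 1) * i.eval σ + h.eval σ := by
  simp [address]

@[simp] theorem eval_incExp (σ : Store) (m : ℕ) (r : NExp) :
    (incExp m r).eval σ = specialInc m (r.eval σ) := rfl

section

variable {inp : Input} {m n N : ℕ} {w : ℕ → ℕ} {C : ℕ → ℕ → ℝ}

theorem relax_spec {σ : Store} {R i h Q : ℕ} (h20 : σ.nat 20 0 0 = i)
    (h21 : σ.nat 21 0 0 = h) (h22 : σ.nat 22 0 0 = Q) (h23 : σ.nat 23 0 0 = R) (hh : h ≤ m)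
    (hw : σ.nat 3 R 0 = w R) (hC : σ.real 2 i R = C i R)
    (hD : (σ.tables m).CellCorrect m w C R i h Q) :
    Runs inp (relax m) σ 1 (fun τ => AgreeOff ((m + 1) * (i + 1) + h) Q σ τ ∧
      (τ.tables m).CellCorrect m w C (R + 1) i h Q) := by
  -- Tests have neither disjunction nor equality; the program spells them out by negated
  -- conjunctions and pairs of inequalities.
  have htest : (relaxTest m).Holds inp σ ↔ Step m w h Q R ∧
      1 ≤ (σ.tables m).valid i (h - specialInc m R) (Q - w R) := by
    simp only [relaxTest, Test.Holds, NExp.eval, NExp.eval_var, h20, h21, h22, h23, hw, predAddress,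
      predWeight, eval_address, eval_incExp, Step, Store.tables]
    refine and_congr (and_congr ?_ Iff.rfl) Iff.rfl
    omega
  have hval : (relaxValue m).eval inp σ =
      (σ.tables m).val i (h - specialInc m R) (Q - w R) + C i R := by
    simp [relaxValue, predAddress, predWeight, h20, h21, h22, h23, hw, hC, Store.tables]
  refine Runs.cond le_rfl (fun hT => ?_) (fun hT => ?_)
  · obtain ⟨hs, hp⟩ := htest.1 hT
    refine Runs.cond le_rfl (fun hT' => ?_) (fun hT' => ?_)
    · have himp : 1 ≤ (σ.tables m).valid (i + 1) h Q →
          (σ.tables m).val i (h - specialInc m R) (Q - w R) + C i R ≤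
            (σ.tables m).val (i + 1) h Q := by
        intro hv
        simp only [Test.Holds, NExp.eval, NExp.eval_var, RExp.eval, h20, h21, h22, cellAddress,
          eval_address, hval] at hT'
        by_contra hcon
        exact hT' ⟨hv, hcon⟩
      refine Runs.comp (Runs.assignNat le_rfl (Runs.comp (Runs.assignReal le_rfl
        (Runs.assignNat le_rfl ?_))))
      -- The new value is evaluated after the validity flag has been written, and does not depend on
      -- that flag.
      have hval' : ∀ v, (relaxValue m).eval inp (σ.setNat 4 ((m + 1) * (i + 1) + h) Q v) =
          (relaxValue m).eval inp σ := by
        intro v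
        simp [relaxValue, predAddress, predWeight]
      simp only [cellAddress, eval_address, NExp.eval, NExp.eval_var, Store.setReal_nat,
        Store.setNat_nat, h20, h21, h22, h23, hval', hval]
      norm_num only [false_and, if_false, h20, h21, h22, h23]
      refine ⟨fun p q hpq => by simp [hpq], hD.succ_of_improved ?_ hs hp himp ?_ ?_ ?_⟩
      · intro h' hh' Q' _
        have : ¬ ((m + 1) * i + h' = (m + 1) * (i + 1) + h) :=
          (address_lt (Nat.lt_succ_self i) (hh'.trans hh)).ne
        simp [Store.tables, this]
      · simp [Store.tables]
      · simp [Store.tables]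
      · simp [Store.tables]
    · refine Runs.skip le_rfl ⟨fun _ _ _ => ⟨rfl, rfl, rfl⟩, hD.succ_of_not fun _ _ => ?_⟩
      simp only [Test.Holds, NExp.eval, NExp.eval_var, RExp.eval, h20, h21, h22, cellAddress,
        eval_address, hval, not_not] at hT'
      exact ⟨hT'.1, (not_le.1 hT'.2).le⟩
  · exact Runs.skip le_rfl ⟨fun _ _ _ => ⟨rfl, rfl, rfl⟩,
      hD.succ_of_not fun hs hp => absurd (htest.2 ⟨hs, hp⟩) hT⟩

theorem cell_spec {σ : Store} {i h Q : ℕ} (h20 : σ.nat 20 0 0 = i)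
    (h21 : σ.nat 21 0 0 = h) (h22 : σ.nat 22 0 0 = Q) (hh : h ≤ m)
    (hw : ∀ r, σ.nat 3 r 0 = w r) (hC : ∀ r < 2 * m + 1, σ.real 2 i r = C i r) :
    Runs inp (cell m) σ (2 * m + 2) (fun τ => AgreeOff ((m + 1) * (i + 1) + h) Q σ τ ∧
      (τ.tables m).CellCorrect m w C (2 * m + 1) i h Q) := by
  refine Runs.comp (Runs.assignNat (by omega) ?_)
  refine (Runs.forLoop (N := 2 * m + 1) (X := 1) (fun R τ =>
    AgreeOff ((m + 1) * (i + 1) + h) Q σ τ ∧ (τ.tables m).CellCorrect m w C R i h Q)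
    le_rfl rfl (fun _ _ => rfl) (fun R τ v hI => ?_) ⟨?_, ?_⟩ ?_).mono (by omega)
  · rw [Store.tables_setNat (by decide) (by decide)]
    exact ⟨fun p q hpq => by simpa using hI.1 p q hpq, hI.2⟩
  · intro p q hpq
    simp [cellAddress, h20, h21, h22, hpq]
  · refine ⟨fun hv => ?_, fun r hr => absurd hr (Nat.not_lt_zero r)⟩
    simp [cellAddress, h20, h21, h22, Store.tables] at hv
  · rintro R hR τ hF h23 ⟨ho, hD⟩
    refine (relax_spec (C := C) ?_ ?_ ?_ h23 hh ?_ ?_ hD).imp ?_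
    · rw [hF.nat 20 rfl]; simpa using h20
    · rw [hF.nat 21 rfl]; simpa using h21
    · rw [hF.nat 22 rfl]; simpa using h22
    · rw [hF.nat 3 rfl]; simpa using hw R
    · rw [hF.real 2 rfl]; exact hC R hR
    · rintro ρ - ⟨ho', hD'⟩
      refine ⟨fun p q hpq => ?_, hD'⟩
      obtain ⟨a, b, c⟩ := ho p q hpq
      obtain ⟨a', b', c'⟩ := ho' p q hpq
      exact ⟨a'.trans a, b'.trans b, c'.trans c⟩

theorem tableBase_spec {σ : Store} (hN : σ.nat 11 0 0 = N) :
    Runs inp (tableBase m) σ ((N + 1) * (m + 2)) (fun τ =>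
      (∀ h ≤ m, ∀ Q < N, (1 ≤ (τ.tables m).valid 0 h Q ↔ h = 0 ∧ Q = 0)) ∧
      (τ.tables m).val 0 0 0 = 0) := by
  have hX : 1 ≤ (N + 1) * (m + 2) := Nat.succ_le_of_lt (by positivity)
  refine Runs.comp ((Runs.forLoop (N := m + 1) (fun h τ => ∀ h' < h, ∀ Q < N, τ.nat 4 h' Q = 0)
    (by omega) rfl (fun _ _ => rfl) (fun i τ v h => by simpa using h) (by simp) ?_).imp ?_)
  · intro h hh τ hF h21 hI
    refine (Runs.forLoop (N := N) (X := 1) (fun Q ρ => (∀ h' < h, ∀ Q < N, ρ.nat 4 h' Q = 0) ∧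
      ∀ Q' < Q, ρ.nat 4 h Q' = 0) le_rfl rfl (fun ρ hρ => ?_)
      (fun i τ v h => by simpa using h) ⟨hI, by simp⟩ ?_).imp ?_ |>.mono (by omega)
    · rw [NExp.eval_var, hρ.nat 11 rfl, hF.nat 11 rfl, hN]
    · rintro Q hQ ρ hρ h22 ⟨h1, h2⟩
      have h21' : ρ.nat 21 0 0 = h := by rw [hρ.nat 21 rfl, h21]
      refine Runs.assignNat le_rfl ⟨fun h' hh' Q' hQ' => ?_, fun Q' hQ' => ?_⟩
      · simp [h1 h' hh' Q' hQ']
      · simp only [Store.setNat_nat, NExp.eval_var, NExp.eval, h21', h22]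
        rcases Nat.lt_succ_iff_lt_or_eq.1 hQ' with h3 | rfl
        · rw [h2 Q' h3, ite_self]
        · simp
    · rintro ρ - ⟨h1, h2⟩ h' hh' Q hQ
      rcases Nat.lt_succ_iff_lt_or_eq.1 hh' with h3 | rfl
      exacts [h1 h' h3 Q hQ, h2 Q hQ]
  · intro τ hF hI
    refine Runs.comp (Runs.assignNat hX (Runs.assignReal hX ⟨fun h hh Q hQ => ?_, ?_⟩))
    · by_cases hc : h = 0 ∧ Q = 0
      · simp [Store.tables, hc]
      · simp [Store.tables, hc, hI h (by omega) Q hQ]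
    · simp [Store.tables]

/-- The tables are correct for all entries before `(i + 1, h, Q)`. -/
structure CorrectBefore (D : Tables) (m : ℕ) (w : ℕ → ℕ) (C : ℕ → ℕ → ℝ) (N i h Q : ℕ) :
    Prop where
  base : ∀ h ≤ m, ∀ Q < N, (1 ≤ D.valid 0 h Q ↔ h = 0 ∧ Q = 0)
  base_val : D.val 0 0 0 = 0
  step : ∀ i' h' Q', h' ≤ m → Q' < N → (i' < i ∨ i' = i ∧ (h' < h ∨ h' = h ∧ Q' < Q)) →
    D.CellCorrect m w C (2 * m + 1) i' h' Q'

theorem tableStep_spec {σ : Store} (hn : σ.nat 0 0 0 = n) (hN : σ.nat 11 0 0 = N)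
    (hw : ∀ r, σ.nat 3 r 0 = w r) (hC : ∀ i < n, ∀ r < 2 * m + 1, σ.real 2 i r = C i r)
    (hbase : ∀ h ≤ m, ∀ Q < N, (1 ≤ (σ.tables m).valid 0 h Q ↔ h = 0 ∧ Q = 0))
    (hval : (σ.tables m).val 0 0 0 = 0) :
    Runs inp (tableStep m) σ ((2 * m + 2) * (N + 1) * (m + 2) * (n + 1))
      (fun τ => (τ.tables m).Correct m w C n N) := by
  refine (Runs.forLoop (N := n) (fun i τ => CorrectBefore (τ.tables m) m w C N i 0 0)
    (Nat.succ_le_of_lt (by positivity)) rfl (fun τ hτ => ?_)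
    (fun i τ v h => by rwa [Store.tables_setNat (by decide) (by decide)])
    ⟨hbase, hval, fun i' h' Q' _ _ h => by omega⟩ ?_).imp ?_
  · rw [NExp.eval_var, hτ.nat 0 rfl, hn]
  · intro i hi τ hF h20 hI
    refine (Runs.forLoop (N := m + 1) (fun h τ => CorrectBefore (τ.tables m) m w C N i h 0)
      (Nat.succ_le_of_lt (by positivity)) rfl (fun _ _ => rfl)
      (fun i τ v h => by rwa [Store.tables_setNat (by decide) (by decide)]) hI ?_).imp ?_
    · intro h hh ρ hFρ h21 hI
      refine (Runs.forLoop (N := N) (fun Q τ => CorrectBefore (τ.tables m) m w C N i h Q)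
        (by omega) rfl (fun ρ' hρ' => ?_)
        (fun i τ v h => by rwa [Store.tables_setNat (by decide) (by decide)]) hI ?_).imp ?_
      · rw [NExp.eval_var, hρ'.nat 11 rfl, hFρ.nat 11 rfl, hF.nat 11 rfl, hN]
      · intro Q hQ κ hFκ h22 hI
        refine (cell_spec (C := C) (w := w) (i := i) (h := h) ?_ ?_ h22 (by omega) ?_ ?_).imp ?_
        · rw [hFκ.nat 20 rfl, hFρ.nat 20 rfl, h20]
        · rw [hFκ.nat 21 rfl, h21]
        · intro r
          rw [hFκ.nat 3 rfl, hFρ.nat 3 rfl, hF.nat 3 rfl, hw]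
        · intro r hr
          rw [hFκ.real 2 rfl, hFρ.real 2 rfl, hF.real 2 rfl, hC i hi r hr]
        · rintro κ' - ⟨ho, hD⟩
          -- Among the layers up to `i + 1`, the computation of one cell alters that cell only.
          have hlow : ∀ i' h' Q', h' ≤ m → ¬ (i' = i + 1 ∧ h' = h ∧ Q' = Q) → i' ≤ i + 1 →
              (κ'.tables m).valid i' h' Q' = (κ.tables m).valid i' h' Q' ∧
              (κ'.tables m).val i' h' Q' = (κ.tables m).val i' h' Q' ∧
              (κ'.tables m).dec i' h' Q' = (κ.tables m).dec i' h' Q' := by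
            intro i' h' Q' hh' hne hle
            refine ho _ _ fun heq => ?_
            rcases hle.lt_or_eq with hlt | rfl
            · exact (address_lt hlt hh').ne heq.1
            · exact hne ⟨rfl, by omega, heq.2⟩
          refine ⟨fun h' hh' Q' hQ' => ?_, ?_, fun i' h' Q' hh' hQ' hlex => ?_⟩
          · rw [(hlow 0 h' Q' hh' (by omega) (by omega)).1]
            exact hI.base h' hh' Q' hQ'
          · rw [(hlow 0 0 0 (by omega) (by omega) (by omega)).2.1]
            exact hI.base_val
          · by_cases heq : i' = i ∧ h' = h ∧ Q' = Q
            · obtain ⟨rfl, rfl, rfl⟩ := heq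
              exact hD
            · refine (hI.step i' h' Q' hh' hQ' (by omega)).congr (fun h'' hh'' Q'' _ => ?_)
                (hlow _ _ _ hh' (by omega) (by omega))
              have := hlow i' h'' Q'' (by omega) (by omega) (by omega)
              exact ⟨this.1, this.2.1⟩
      · rintro κ - hI
        exact ⟨hI.base, hI.base_val, fun i' h' Q' hh' hQ' hlex =>
          hI.step i' h' Q' hh' hQ' (by omega)⟩
    · rintro κ - hI
      exact ⟨hI.base, hI.base_val, fun i' h' Q' hh' hQ' hlex =>
        hI.step i' h' Q' hh' hQ' (by omega)⟩
  · rintro τ - hI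
    exact ⟨hI.base, hI.base_val, fun i hi h hh Q hQ => hI.step i h Q hh hQ (Or.inl hi)⟩

end

/-! ### Candidates -/

section

variable {m n : ℕ} {I : UniformInstance m n}

theorem backtrack_spec {σ : Store} {h Q : ℕ} {a : ℕ → ℕ} {π : Pattern m} {w : ℕ → ℕ}
    (hn : σ.nat 0 0 0 = n) (h20 : σ.nat 20 0 0 = h) (h21 : σ.nat 21 0 0 = Q)
    (hw : ∀ r, σ.nat 3 r 0 = w r)
    (hR : ∀ r < 2 * m + 1, ∀ j < m, σ.real 1 r j = I.row π r j)
    (ha : ∀ i < n, a i < 2 * m + 1) (hrec : (σ.tables m).Recorded m w n h Q a) :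
    Runs I.input (backtrack m) σ ((m + 1) * (n + 1)) (fun τ => ∀ i < n, τ.nat 6 i 0 = used (a i) ∧
      ∀ j < m, τ.real 4 i j = I.row π (a i) j) := by
  have hX : 1 ≤ (m + 1) * (n + 1) := Nat.succ_le_of_lt (by positivity)
  refine Runs.comp (Runs.setVar hX (Runs.comp (Runs.setVar hX ?_)))
  -- After `k` passes the scalars `9` and `10` hold the parameters in layer `n - k` from which the
  -- remaining types are recorded, and the facilities from `n - k` on have been written.
  refine (Runs.forLoop (N := n) (X := m + 1) (fun k τ =>
    (σ.tables m).Recorded m w (n - k) (τ.nat 9 0 0) (τ.nat 10 0 0) a ∧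
      ∀ i < n, n - k ≤ i → τ.nat 6 i 0 = used (a i) ∧
        ∀ j < m, τ.real 4 i j = I.row π (a i) j) (by omega) rfl (fun τ hτ => ?_)
    (fun i τ v h => by simpa using h) ?_ ?_).imp ?_
  · rw [NExp.eval_var, hτ.nat 0 rfl]; simpa using hn
  · refine ⟨by simpa [h20, h21] using hrec, fun i hi hi' => by omega⟩
  · rintro k hk τ hF h22 ⟨hrec, hI⟩
    have hn' : τ.nat 0 0 0 = n := by rw [hF.nat 0 rfl]; simpa using hn
    have hD : τ.nat 5 = σ.nat 5 := by rw [hF.nat 5 rfl]; rfl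
    have hW : ∀ r, τ.nat 3 r 0 = w r := fun r => by rw [hF.nat 3 rfl]; simpa using hw r
    have hR' : ∀ r < 2 * m + 1, ∀ j < m, τ.real 1 r j = I.row π r j := fun r hr j hj => by
      rw [hF.real 1 rfl]; simpa using hR r hr j hj
    obtain ⟨i, hi⟩ : ∃ i, n - k = i + 1 := ⟨n - k - 1, by omega⟩
    rw [hi] at hrec
    obtain ⟨hdec, hrec⟩ := hrec
    have hdec' : τ.nat 5 ((m + 1) * (n - k) + τ.nat 9 0 0) (τ.nat 10 0 0) = a i := by
      rw [hdec, hD, hi]; rfl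
    refine Runs.comp (Runs.setVar (by omega) ?_)
    refine Runs.comp (Runs.assignNat (by omega) ?_)
    set τ' := (τ.setNat 13 0 0 (NExp.eval τ (.get 5 (address m (.sub (.var 0) (.var 22)) (.var 9))
      (.var 10)))).setNat 6 i 0 (used (a i)) with hτ'
    -- With truncated subtraction, `1 - (1 - a i)` is `used (a i)`.
    have hstate : (τ.setNat 13 0 0 (NExp.eval τ (.get 5 (address m (.sub (.var 0) (.var 22))
        (.var 9)) (.var 10)))).setNat 6 i 0 (1 - (1 - a i)) = τ' := by
      rw [hτ']
      congr 1
      unfold used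
      split_ifs <;> omega
    simp only [NExp.eval, NExp.eval_var, Store.setNat_nat, eval_address, hn', h22, hdec'] at hstate ⊢
    norm_num only [false_and, if_false, if_true, and_self, hn', h22] at hstate ⊢
    rw [hi, Nat.add_sub_cancel, hstate]
    have hτ'13 : τ'.nat 13 0 0 = a i := by
      simp [hτ', hn', h22, hdec']
    refine Runs.seq (Runs.mono (Runs.forLoop (N := m) (X := 1) (fun j ρ =>
      (∀ j' < j, ρ.real 4 i j' = I.row π (a i) j') ∧
      ∀ p q, p ≠ i → ρ.real 4 p q = τ.real 4 p q) le_rfl rfl (fun _ _ => rfl) (fun _ _ _ h => h)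
      ⟨by simp, fun p q _ => by simp [hτ']⟩ ?_) (by omega)) ?_
    · rintro j hj ρ hρ h23 ⟨h1, h2⟩
      have e0 : ρ.nat 0 0 0 = n := by rw [hρ.nat 0 rfl]; simpa [hτ'] using hn'
      have e22 : ρ.nat 22 0 0 = k := by rw [hρ.nat 22 rfl]; simpa [hτ'] using h22
      have e13 : ρ.nat 13 0 0 = a i := by rw [hρ.nat 13 rfl, hτ'13]
      have e1 : ρ.real 1 (a i) j = I.row π (a i) j := by
        rw [hρ.real 1 rfl]; simpa [hτ'] using hR' _ (ha i (by omega)) j hj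
      refine Runs.assignReal le_rfl ⟨fun j' hj' => ?_, fun p q hp => ?_⟩
      · simp only [NExp.eval, NExp.eval_var, Store.setReal_real, RExp.eval, e0, e22, h23, e13, e1,
          hi, Nat.add_sub_cancel]
        rcases Nat.lt_succ_iff_lt_or_eq.1 hj' with h3 | rfl
        · simp [h3.ne, h1 j' h3]
        · simp
      · simp [e0, e22, hi, hp, h2 p q hp]
    · rintro ρ hρ ⟨h1, h2⟩
      have e13 : ρ.nat 13 0 0 = a i := by rw [hρ.nat 13 rfl, hτ'13]
      have e9 : ρ.nat 9 0 0 = τ.nat 9 0 0 := by rw [hρ.nat 9 rfl]; simp [hτ']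
      have e10 : ρ.nat 10 0 0 = τ.nat 10 0 0 := by rw [hρ.nat 10 rfl]; simp [hτ']
      have e3 : ∀ r, ρ.nat 3 r 0 = w r := fun r => by rw [hρ.nat 3 rfl]; simp [hτ', hW]
      have e6 : ∀ i', ρ.nat 6 i' 0 = if i' = i then used (a i) else τ.nat 6 i' 0 := fun i' => by
        rw [hρ.nat 6 rfl]; simp [hτ']
      refine Runs.comp (Runs.setVar (by omega) (Runs.setVar (by omega) ⟨?_, fun i' hi' hle => ?_⟩))
      · rw [show n - (k + 1) = i by omega]
        simpa [e13, e9, e10, e3] using hrec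
      · simp only [Store.setNat_nat, Store.setNat_real]
        norm_num only [false_and, if_false]
        rw [e6]
        by_cases hii : i' = i
        · subst hii
          simpa using h1
        · rw [if_neg hii]
          refine ⟨(hI i' hi' (by omega)).1, fun j hj => ?_⟩
          rw [h2 _ _ hii]
          exact (hI i' hi' (by omega)).2 j hj
  · rintro τ - ⟨-, hI⟩ i hi
    exact hI i hi (by omega)

theorem require_spec {inp : Input} {b : Test} {σ : Store} {X : ℕ} (hX : 1 ≤ X) :
    Runs inp (require b) σ X (fun τ => 1 ≤ τ.nat 7 0 0 ↔ 1 ≤ σ.nat 7 0 0 ∧ b.Holds inp σ) :=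
  Runs.cond hX (fun hb => Runs.skip hX (by simp [hb])) fun hb => Runs.setVar hX (by simp [hb])

theorem checkRows_spec {σ : Store} (hn : σ.nat 0 0 0 = n)
    (hy : ∀ i < n, σ.nat 6 i 0 = 0 ∨ σ.nat 6 i 0 = 1) :
    Runs I.input (checkRows m) σ ((m + 1) * (n + 1)) (fun τ =>
      (1 ≤ τ.nat 7 0 0 ↔ ∀ i < n, (∀ j < m, 0 ≤ σ.real 4 i j) ∧
        ∑ j ∈ Finset.range m, σ.real 4 i j ≤ I.s * (σ.nat 6 i 0 : ℝ)) ∧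
      τ.nat 8 0 0 = ∑ i ∈ Finset.range n, σ.nat 6 i 0) := by
  have hX : 1 ≤ (m + 1) * (n + 1) := Nat.succ_le_of_lt (by positivity)
  refine Runs.comp (Runs.setVar hX (Runs.comp (Runs.setVar hX ?_)))
  refine Runs.forLoop (N := n) (X := m + 1) (fun k τ =>
      (1 ≤ τ.nat 7 0 0 ↔ ∀ i < k, (∀ j < m, 0 ≤ σ.real 4 i j) ∧
        ∑ j ∈ Finset.range m, σ.real 4 i j ≤ I.s * (σ.nat 6 i 0 : ℝ)) ∧
      τ.nat 8 0 0 = ∑ i ∈ Finset.range k, σ.nat 6 i 0) (by omega) rfl (fun τ hτ => ?_)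
    (fun i τ v h => by simpa using h) (by simp) ?_
  · rw [NExp.eval_var, hτ.nat 0 rfl]; simpa using hn
  rintro i hi τ hF h22 ⟨h7, h8⟩
  have hx : τ.real 4 = σ.real 4 := by rw [hF.real 4 rfl]; rfl
  have hy6 : τ.nat 6 i 0 = σ.nat 6 i 0 := by rw [hF.nat 6 rfl]; simp
  refine Runs.comp (Runs.setVar (by omega) (Runs.comp (Runs.setRealVar (by omega) ?_)))
  refine Runs.seq (Runs.mono (Runs.forLoop (N := m) (X := 1) (fun j ρ =>
      (1 ≤ ρ.nat 7 0 0 ↔ 1 ≤ τ.nat 7 0 0 ∧ ∀ j' < j, 0 ≤ σ.real 4 i j') ∧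
      ρ.real 7 0 0 = ∑ j' ∈ Finset.range j, σ.real 4 i j') le_rfl rfl (fun _ _ => rfl)
      (fun i τ v h => by simpa using h) (by simp) ?_) (by omega)) ?_
  · rintro j hj ρ hρ h23 ⟨h1, h2⟩
    have e22 : ρ.nat 22 0 0 = i := by rw [hρ.nat 22 rfl]; simpa using h22
    have e4 : ρ.real 4 = σ.real 4 := by rw [hρ.real 4 rfl, ← hx]; funext p q; simp
    refine Runs.comp (Runs.setRealVar le_rfl ((require_spec le_rfl).imp fun κ hκ h => ⟨?_, ?_⟩))
    · rw [h, Nat.forall_lt_succ_right, ← and_assoc, ← h1]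
      simp [Test.Holds, e22, h23, e4]
    · rw [hκ.real 7 rfl]
      simp [e22, h23, e4, h2, Finset.sum_range_succ]
  · rintro ρ hρ ⟨h1, h2⟩
    have e22 : ρ.nat 22 0 0 = i := by rw [hρ.nat 22 rfl]; simpa using h22
    have e6 : ρ.nat 6 i 0 = σ.nat 6 i 0 := by rw [hρ.nat 6 rfl]; simpa using hy6
    have e8 : ρ.nat 8 0 0 = ∑ i ∈ Finset.range (i + 1), σ.nat 6 i 0 := by
      rw [hρ.nat 8 rfl]; simp [h8, h22, hy6, Finset.sum_range_succ]
    -- A natural number cannot serve as a real factor, so the bound `s * y` is tested as `s` or `0`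
    -- according to the value of `y`.
    refine Runs.imp (Φ := fun κ => (1 ≤ κ.nat 7 0 0 ↔ 1 ≤ ρ.nat 7 0 0 ∧
      ∑ j ∈ Finset.range m, σ.real 4 i j ≤ I.s * (σ.nat 6 i 0 : ℝ)))
      (Runs.cond (by omega) (fun hT => (require_spec (by omega)).imp fun κ _ h => ?_)
        (fun hT => (require_spec (by omega)).imp fun κ _ h => ?_)) fun κ hκ h => ⟨?_, ?_⟩
    · simp only [Test.Holds, NExp.eval, NExp.eval_var, e22, e6] at hT
      have : σ.nat 6 i 0 = 1 := by rcases hy i hi with h | h <;> omega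
      rw [h, this]
      simp [Test.Holds, UniformInstance.input, h2]
    · simp only [Test.Holds, NExp.eval, NExp.eval_var, e22, e6] at hT
      have : σ.nat 6 i 0 = 0 := by rcases hy i hi with h | h <;> omega
      rw [h, this]
      simp [Test.Holds, h2]
    · rw [h, h1, h7]
      simp only [Nat.forall_lt_succ_right, and_assoc]
    · rw [hκ.nat 8 rfl, e8]

theorem checkColumns_spec {σ : Store} (hn : σ.nat 0 0 0 = n) :
    Runs I.input (checkColumns m) σ ((m + 1) * (n + 1)) (fun τ =>
      (1 ≤ τ.nat 7 0 0 ↔ 1 ≤ σ.nat 7 0 0 ∧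
        ∀ j < m, ∑ i ∈ Finset.range n, σ.real 4 i j = I.input .demand j 0)) := by
  rw [mul_comm]
  refine Runs.forLoop (N := m) (X := n + 1) (fun k τ =>
      (1 ≤ τ.nat 7 0 0 ↔ 1 ≤ σ.nat 7 0 0 ∧
        ∀ j < k, ∑ i ∈ Finset.range n, σ.real 4 i j = I.input .demand j 0)) (by omega) rfl
    (fun _ _ => rfl) (fun i τ v h => by simpa using h) (by simp) ?_
  rintro j hj τ hF h23 h7
  refine Runs.comp (Runs.setRealVar (by omega) ?_)
  refine Runs.seq (Runs.mono (Runs.forLoop (N := n) (X := 1) (fun i ρ =>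
      ρ.real 7 0 0 = ∑ i' ∈ Finset.range i, σ.real 4 i' j) le_rfl rfl (fun ρ hρ => ?_)
      (fun i τ v h => by simpa using h) (by simp) ?_) (by omega)) ?_
  · rw [NExp.eval_var, hρ.nat 0 rfl]
    change τ.nat 0 0 0 = n
    rw [hF.nat 0 rfl, hn]
  · rintro i hi ρ hρ h22 h
    have e23 : ρ.nat 23 0 0 = j := by rw [hρ.nat 23 rfl]; simpa using h23
    have e4 : ρ.real 4 = σ.real 4 := by
      rw [hρ.real 4 rfl, ← hF.real 4 rfl]; funext p q; simp
    refine Runs.setRealVar le_rfl ?_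
    simp [h, e23, e4, h22, Finset.sum_range_succ]
  · rintro ρ hρ h
    have e23 : ρ.nat 23 0 0 = j := by rw [hρ.nat 23 rfl]; simpa using h23
    have e7 : ρ.nat 7 0 0 = τ.nat 7 0 0 := by rw [hρ.nat 7 rfl]; simp
    refine (require_spec (by omega)).imp fun κ _ hκ => ?_
    rw [hκ, e7, h7]
    simp only [Test.Holds, RExp.eval, RExp.eval_var, NExp.eval, NExp.eval_var, e23, h,
      ← le_antisymm_iff, Nat.forall_lt_succ_right, and_assoc]

/-- The candidate `(x, y)` in the memory is feasible. -/
def CandidateFeasible (I : UniformInstance m n) (σ : Store) : Prop :=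
  I.IsFeasible (fun i j => σ.real 4 i j) (fun i => σ.nat 6 i 0)

theorem check_spec {σ : Store} (hn : σ.nat 0 0 0 = n) (hk : σ.nat 0 0 1 = I.k)
    (hy : ∀ i < n, σ.nat 6 i 0 = 0 ∨ σ.nat 6 i 0 = 1) :
    Runs I.input (check m) σ ((m + 1) * (n + 1)) (fun τ =>
      1 ≤ τ.nat 7 0 0 ↔ CandidateFeasible I σ) := by
  refine (checkRows_spec hn hy).seq fun τ hF ⟨h7, h8⟩ => ?_
  refine (checkColumns_spec (by rw [hF.nat 0 rfl, hn])).seq fun ρ hF' h7' => ?_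
  refine (require_spec (Nat.succ_le_of_lt (by positivity))).imp fun κ _ hκ => ?_
  have e8 : ρ.nat 8 0 0 = ∑ i ∈ Finset.range n, σ.nat 6 i 0 := by rw [hF'.nat 8 rfl, h8]
  have e0 : ρ.nat 0 0 1 = I.k := by rw [hF'.nat 0 rfl, hF.nat 0 rfl, hk]
  rw [hκ, h7', h7, hF.real 4 rfl]
  simp only [Test.Holds, NExp.eval, NExp.eval_var, e8, e0]
  constructor
  · rintro ⟨⟨h1, h2⟩, h3⟩
    refine ⟨fun j => ?_, fun i => ?_, ?_, fun i j => (h1 i i.2).1 j j.2, fun i => hy i i.2⟩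
    · rw [Fin.sum_univ_eq_sum_range (fun i => σ.real 4 i j), h2 j j.2]
      simp [UniformInstance.input]
    · rw [Fin.sum_univ_eq_sum_range (fun j => σ.real 4 i j)]
      exact (h1 i i.2).2
    · rwa [Fin.sum_univ_eq_sum_range (fun i => σ.nat 6 i 0)]
  · intro h
    refine ⟨⟨fun i hi => ⟨fun j hj => h.nonneg ⟨i, hi⟩ ⟨j, hj⟩, ?_⟩, fun j hj => ?_⟩, ?_⟩
    · rw [← Fin.sum_univ_eq_sum_range (fun j => σ.real 4 i j)]
      exact h.capacity ⟨i, hi⟩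
    · rw [← Fin.sum_univ_eq_sum_range (fun i => σ.real 4 i j)]
      exact (h.demand ⟨j, hj⟩).trans (by simp [UniformInstance.input, hj])
    · rw [← Fin.sum_univ_eq_sum_range (fun i => σ.nat 6 i 0)]
      exact h.cardinality

/-! ### The best solution found so far -/

/-- The output is a feasible solution with the recorded cost. -/
def OutputCorrect (I : UniformInstance m n) (σ : Store) : Prop :=
  I.IsFeasible (fun i j => σ.real 0 i j) (fun i => σ.nat 2 i 0) ∧
    I.totalCost (fun i j => σ.real 0 i j) (fun i => σ.nat 2 i 0) = σ.real 6 0 0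

/-- If the flag is set, then the output is correct, and it is set and the output costs at most `v`
for all `v` in `V`. -/
def BestOf (I : UniformInstance m n) (V : Set ℝ) (σ : Store) : Prop :=
  (σ.nat 1 0 0 = 0 ∨ σ.nat 1 0 0 = 1 ∧ OutputCorrect I σ) ∧
    ∀ v ∈ V, σ.nat 1 0 0 = 1 ∧ σ.real 6 0 0 ≤ v

theorem BestOf.congr {V : Set ℝ} {σ τ : Store} (h : BestOf I V σ) (h1 : τ.nat 1 = σ.nat 1)
    (h2 : τ.nat 2 = σ.nat 2) (h0 : τ.real 0 = σ.real 0) (h6 : τ.real 6 = σ.real 6) :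
    BestOf I V τ := by
  unfold BestOf OutputCorrect
  rw [h1, h2, h0, h6]
  exact h

theorem update_spec {σ : Store} {h Q : ℕ} {V : Set ℝ} {v : ℝ} (hn : σ.nat 0 0 0 = n)
    (h20 : σ.nat 20 0 0 = h) (h21 : σ.nat 21 0 0 = Q)
    (hok : 1 ≤ σ.nat 7 0 0 ↔ CandidateFeasible I σ) (hval : (σ.tables m).val n h Q = v)
    (hcost : I.totalCost (fun i j => σ.real 4 i j) (fun i => σ.nat 6 i 0) = v)
    (hV : BestOf I V σ) :
    Runs I.input (update m) σ ((m + 1) * (n + 1)) (fun τ =>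
      BestOf I V τ ∧ (CandidateFeasible I σ → τ.nat 1 0 0 = 1 ∧ τ.real 6 0 0 ≤ v)) := by
  have hX : 1 ≤ (m + 1) * (n + 1) := Nat.succ_le_of_lt (by positivity)
  have hcc : (candidateCost m).eval I.input σ = v := by
    rw [← hval]
    simp [candidateCost, hn, h20, h21, Store.tables]
  have hcc' : (candidateCost m).eval I.input (σ.setNat 1 0 0 1) = v := by
    rw [← hcc]
    simp [candidateCost]
  refine Runs.cond hX (fun hT => ?_) (fun hT => Runs.skip hX ⟨hV, fun hf => ?_⟩)
  · simp only [Test.Holds, NExp.eval, NExp.eval_var, RExp.eval_var, hcc] at hT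
    obtain ⟨h7, h1⟩ := hT
    have hf := hok.1 h7
    refine Runs.comp (Runs.setVar hX (Runs.comp (Runs.setRealVar hX ?_)))
    simp only [NExp.eval, hcc']
    refine (Runs.forLoop (N := n) (X := m + 1) (fun i τ => ∀ i' < i, τ.nat 2 i' 0 = σ.nat 6 i' 0 ∧
      ∀ j < m, τ.real 0 i' j = σ.real 4 i' j) (by omega) rfl (fun ρ hρ => ?_)
      (fun i τ v h => by simpa using h) (by simp) ?_).imp fun τ hF hτ => ?_
    · rw [NExp.eval_var, hρ.nat 0 rfl]; simpa using hn
    · rintro i hi τ hF h22 hI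
      have e6 : τ.nat 6 i 0 = σ.nat 6 i 0 := by rw [hF.nat 6 rfl]; simp
      have e4 : τ.real 4 = σ.real 4 := by rw [hF.real 4 rfl]; funext p q; simp
      refine Runs.comp (Runs.assignNat (by omega) ?_)
      simp only [NExp.eval, NExp.eval_var, h22, e6]
      refine Runs.mono (Runs.imp (Runs.forLoop (N := m) (X := 1) (fun j ρ => (∀ i' < i, ∀ j < m,
          ρ.real 0 i' j = σ.real 4 i' j) ∧ ∀ j' < j, ρ.real 0 i j' = σ.real 4 i j') le_rfl rfl
        (fun _ _ => rfl) (fun _ _ _ h => h) ⟨fun i' hi' => (hI i' hi').2, by simp⟩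
        ?_) ?_) (by omega)
      · rintro j hj ρ hρ h23 ⟨h1, h2⟩
        have e22 : ρ.nat 22 0 0 = i := by rw [hρ.nat 22 rfl]; simpa using h22
        have e4' : ρ.real 4 = σ.real 4 := by rw [hρ.real 4 rfl]; exact e4
        refine Runs.assignReal le_rfl ⟨fun i' hi' j' hj' => ?_, fun j' hj' => ?_⟩
        · simp [e22, hi'.ne, h1 i' hi' j' hj']
        · simp only [Store.setReal_real, RExp.eval, NExp.eval_var, e22, h23, e4']
          rcases Nat.lt_succ_iff_lt_or_eq.1 hj' with h3 | rfl
          · simp [h3.ne, h2 j' h3]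
          · simp
      · rintro ρ hρ ⟨h1, h2⟩ i' hi'
        rw [hρ.nat 2 rfl]
        rcases Nat.lt_succ_iff_lt_or_eq.1 hi' with h3 | rfl
        · exact ⟨by simp [h3.ne, (hI i' h3).1], h1 i' h3⟩
        · exact ⟨by simp, h2⟩
    · have e1 : τ.nat 1 0 0 = 1 := by rw [hF.nat 1 rfl]; simp
      have e6 : τ.real 6 0 0 = v := by rw [hF.real 6 rfl]; simp
      have ex : (fun (i : Fin n) (j : Fin m) => τ.real 0 i j) =
          fun (i : Fin n) (j : Fin m) => σ.real 4 i j := by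
        funext i j; exact (hτ i i.2).2 j j.2
      have ey : (fun i : Fin n => τ.nat 2 i 0) = fun i : Fin n => σ.nat 6 i 0 := by
        funext i; exact (hτ i i.2).1
      refine ⟨⟨Or.inr ⟨e1, ?_, ?_⟩, fun u hu => ⟨e1, ?_⟩⟩, fun _ => ⟨e1, e6.le⟩⟩
      · rw [ex, ey]; exact hf
      · rw [ex, ey, e6, hcost]
      -- Otherwise the old output would exist and be cheaper than the candidate, and the test would
      -- have kept it.
      · obtain ⟨hu1, hu2⟩ := hV.2 u hu
        rw [e6]
        by_contra hcon
        exact h1 ⟨hu1.ge, fun h => hcon (h.trans hu2)⟩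
  · simp only [Test.Holds, NExp.eval, NExp.eval_var, RExp.eval_var, hcc] at hT
    have h7 := hok.2 hf
    have : 1 ≤ σ.nat 1 0 0 ∧ ¬ v ≤ σ.real 6 0 0 := by
      by_contra hcon
      exact hT ⟨h7, hcon⟩
    refine ⟨?_, (not_le.1 this.2).le⟩
    rcases hV.1 with h | h
    · omega
    · exact h.1

end

/-! ### Correctness of the program -/

section

variable {m n : ℕ} {I : UniformInstance m n} {π : Pattern m}

/-- The memory holds the sizes of the instance, the number of total weights and the weights. -/
structure Prepared (I : UniformInstance m n) (σ : Store) : Prop where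
  size : σ.nat 0 0 0 = n
  bound : σ.nat 0 0 1 = I.k
  weights : σ.nat 11 0 0 = (n + 1) ^ m
  weight : ∀ r, σ.nat 3 r 0 = typeWeight m (n + 1) r

theorem Prepared.congr {σ τ : Store} (h : Prepared I σ) (h0 : τ.nat 0 = σ.nat 0)
    (h3 : τ.nat 3 = σ.nat 3) (h11 : τ.nat 11 = σ.nat 11) : Prepared I τ :=
  ⟨by rw [h0, h.size], by rw [h0, h.bound], by rw [h11, h.weights], fun r => by rw [h3, h.weight]⟩

/-- The memory moreover holds the rows and the tables that belong to `π`. -/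
structure Tabulated (I : UniformInstance m n) (π : Pattern m) (σ : Store) : Prop
    extends Prepared I σ where
  rows : ∀ r < 2 * m + 1, ∀ j < m, σ.real 1 r j = I.row π r j
  tables : (σ.tables m).Correct m (typeWeight m (n + 1)) (I.rowCost π) n ((n + 1) ^ m)

/-- If any feasible chain has parameters `(h, Q)`, then the recorded chain is feasible too, by
`ChainFeasible.transfer`, and it is at most as expensive, by `Tables.Correct.val_le`. If the entry
is invalid, no chain has these parameters. -/
theorem candidate_spec {σ : Store} {h Q : ℕ} {V : Set ℝ} (hσ : Tabulated I π σ)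
    (h20 : σ.nat 20 0 0 = h) (h21 : σ.nat 21 0 0 = Q) (hh : h ≤ m) (hQ : Q < (n + 1) ^ m)
    (hV : BestOf I V σ) :
    Runs I.input (.cond (.natLE (.const 1) (.get 4 (address m (.var 0) (.var 20)) (.var 21)))
      (.seq (backtrack m) (.seq (check m) (update m))) .skip) σ ((m + 1) * (n + 1))
      (BestOf I (V ∪ {v | I.Attains π h Q v})) := by
  have hX : 1 ≤ (m + 1) * (n + 1) := Nat.succ_le_of_lt (by positivity)
  refine Runs.cond hX (fun hT => ?_) (fun hT => Runs.skip hX ?_)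
  · simp only [Test.Holds, NExp.eval, NExp.eval_var, eval_address, hσ.size, h20, h21] at hT
    obtain ⟨a, ha⟩ := (σ.tables m).exists_recorded m (typeWeight m (n + 1)) n h Q
    obtain ⟨hc, hval⟩ := hσ.tables.chain ha le_rfl hh hQ hT
    have hlt : ∀ i < n, a i < 2 * m + 1 := fun i hi => by
      rcases hc.type_cases hi with h1 | ⟨t, ht, h1⟩ <;> omega
    refine (backtrack_spec hσ.size h20 h21 hσ.weight hσ.rows hlt ha).seq fun τ hF hτ => ?_
    have ex : (fun (i : Fin n) (j : Fin m) => τ.real 4 i j) =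
        fun (i : Fin n) (j : Fin m) => I.row π (a i) j := by
      funext i j; exact (hτ i i.2).2 j j.2
    have ey : (fun i : Fin n => τ.nat 6 i 0) = fun i : Fin n => used (a i) := by
      funext i; exact (hτ i i.2).1
    refine (check_spec (I := I) (by rw [hF.nat 0 rfl, hσ.size]) (by rw [hF.nat 0 rfl, hσ.bound])
      fun i hi => ?_).seq fun ρ hF' hρ => ?_
    · rw [(hτ i hi).1]
      unfold used
      split_ifs <;> simp
    have hcand : CandidateFeasible I ρ ↔ CandidateFeasible I τ := by
      unfold CandidateFeasible
      rw [hF'.real 4 rfl, hF'.nat 6 rfl]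
    have hVρ : BestOf I V ρ := (hV.congr (hF.nat 1 rfl) (hF.nat 2 rfl) (hF.real 0 rfl)
      (hF.real 6 rfl)).congr (hF'.nat 1 rfl) (hF'.nat 2 rfl) (hF'.real 0 rfl) (hF'.real 6 rfl)
    refine (update_spec (h := h) (Q := Q) (v := ∑ k ∈ Finset.range n, I.rowCost π k (a k)) ?_ ?_ ?_
      (hρ.trans hcand.symm) ?_ ?_ hVρ).imp fun κ _ ⟨hκ, hgood⟩ => ⟨hκ.1, fun v hv => ?_⟩
    · rw [hF'.nat 0 rfl, hF.nat 0 rfl, hσ.size]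
    · rw [hF'.nat 20 rfl, hF.nat 20 rfl, h20]
    · rw [hF'.nat 21 rfl, hF.nat 21 rfl, h21]
    · rw [← hval, Store.tables_congr (σ := σ) (by rw [hF'.nat 4 rfl, hF.nat 4 rfl])
        (by rw [hF'.real 3 rfl, hF.real 3 rfl]) (by rw [hF'.nat 5 rfl, hF.nat 5 rfl])]
    · rw [hF'.real 4 rfl, hF'.nat 6 rfl, ex, ey, UniformInstance.totalCost_chain]
    · rcases hv with hv | ⟨a', hc', hf', rfl⟩
      · exact hκ.2 v hv
      · have hf : CandidateFeasible I ρ := by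
          rw [hcand, CandidateFeasible, ex, ey]
          exact UniformInstance.ChainFeasible.transfer hc' hc hf'
        obtain ⟨h1, h2⟩ := hgood hf
        refine ⟨h1, h2.trans ?_⟩
        rw [← hval]
        exact (hσ.tables.val_le hc' le_rfl hh hQ).2
  · refine ⟨hV.1, fun v hv => ?_⟩
    rcases hv with hv | ⟨a', hc', -, -⟩
    · exact hV.2 v hv
    · refine absurd ?_ hT
      simp only [Test.Holds, NExp.eval, NExp.eval_var, eval_address, hσ.size, h20, h21]
      exact (hσ.tables.val_le hc' le_rfl hh hQ).1

theorem Tabulated.congr {σ τ : Store} (h : Tabulated I π σ) (h0 : τ.nat 0 = σ.nat 0)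
    (h3 : τ.nat 3 = σ.nat 3) (h11 : τ.nat 11 = σ.nat 11) (h1 : τ.real 1 = σ.real 1)
    (h4 : τ.nat 4 = σ.nat 4) (h3' : τ.real 3 = σ.real 3) (h5 : τ.nat 5 = σ.nat 5) :
    Tabulated I π τ :=
  ⟨h.toPrepared.congr h0 h3 h11, by rw [h1]; exact h.rows,
    by rw [Store.tables_congr h4 h3' h5]; exact h.tables⟩

theorem BestOf.mono {V V' : Set ℝ} {σ : Store} (h : BestOf I V σ) (hV : V' ⊆ V) : BestOf I V' σ :=
  ⟨h.1, fun v hv => h.2 v (hV hv)⟩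

theorem BestOf.setNat {V : Set ℝ} {σ : Store} (h : BestOf I V σ) {a p q v : ℕ} (h1 : 1 ≠ a)
    (h2 : 2 ≠ a) : BestOf I V (σ.setNat a p q v) :=
  h.congr (by funext p' q'; simp [h1]) (by funext p' q'; simp [h2]) rfl rfl

theorem scan_spec {σ : Store} {V : Set ℝ} (hσ : Tabulated I π σ) (hV : BestOf I V σ) :
    Runs I.input (scan m) σ ((m + 1) * (n + 1) * ((n + 1) ^ m + 1) * (m + 2))
      (BestOf I (V ∪ {v | ∃ h ≤ m, ∃ Q < (n + 1) ^ m, I.Attains π h Q v})) := by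
  refine (Runs.forLoop (N := m + 1) (fun h τ => BestOf I
    (V ∪ {v | ∃ h' < h, ∃ Q < (n + 1) ^ m, I.Attains π h' Q v}) τ)
    (Nat.succ_le_of_lt (by positivity)) rfl (fun _ _ => rfl)
    (fun i τ v h => h.setNat (by decide) (by decide)) (hV.mono (by simp)) ?_).imp ?_
  · intro h hh τ hF h20 hI
    refine (Runs.forLoop (N := (n + 1) ^ m) (fun Q τ => BestOf I
      (V ∪ {v | ∃ h' < h, ∃ Q < (n + 1) ^ m, I.Attains π h' Q v} ∪
        {v | ∃ Q' < Q, I.Attains π h Q' v}) τ)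
      (Nat.succ_le_of_lt (by positivity)) rfl (fun ρ hρ => ?_)
      (fun i τ v h => h.setNat (by decide) (by decide)) (hI.mono (by simp)) ?_).imp ?_
    · rw [NExp.eval_var, hρ.nat 11 rfl, hF.nat 11 rfl, hσ.weights]
    · intro Q hQ ρ hFρ h21 hI
      refine (candidate_spec (h := h) (Q := Q) (hσ.congr ?_ ?_ ?_ ?_ ?_ ?_ ?_) ?_ h21 (by omega) hQ
        hI).imp fun κ _ hκ => hκ.mono ?_
      · rw [hFρ.nat 0 rfl, hF.nat 0 rfl]
      · rw [hFρ.nat 3 rfl, hF.nat 3 rfl]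
      · rw [hFρ.nat 11 rfl, hF.nat 11 rfl]
      · rw [hFρ.real 1 rfl, hF.real 1 rfl]
      · rw [hFρ.nat 4 rfl, hF.nat 4 rfl]
      · rw [hFρ.real 3 rfl, hF.real 3 rfl]
      · rw [hFρ.nat 5 rfl, hF.nat 5 rfl]
      · rw [hFρ.nat 20 rfl, h20]
      · rintro v (hv | ⟨Q', hQ', hv⟩)
        · exact Or.inl (Or.inl hv)
        · rcases Nat.lt_succ_iff_lt_or_eq.1 hQ' with h3 | rfl
          · exact Or.inl (Or.inr ⟨Q', h3, hv⟩)
          · exact Or.inr hv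
    · rintro ρ - hρ
      refine hρ.mono ?_
      rintro v (hv | ⟨h', hh', Q, hQ, hv⟩)
      · exact Or.inl (Or.inl hv)
      · rcases Nat.lt_succ_iff_lt_or_eq.1 hh' with h3 | rfl
        · exact Or.inl (Or.inr ⟨h', h3, Q, hQ, hv⟩)
        · exact Or.inr ⟨Q, hQ, hv⟩
  · rintro τ - hτ
    refine hτ.mono ?_
    rintro v (hv | ⟨h, hh, Q, hQ, hv⟩)
    exacts [Or.inl hv, Or.inr ⟨h, by omega, Q, hQ, hv⟩]

/-- A bound, up to a constant, for the time of the program. -/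
def timeBound (m n : ℕ) : ℕ := (2 * m + 2) * ((n + 1) ^ m + 1) * (m + 2) * (n + 1)

theorem mul_le_timeBound {m n a : ℕ} (ha : a ≤ (2 * m + 2) * ((n + 1) ^ m + 1) * (m + 2)) :
    a * (n + 1) ≤ timeBound m n :=
  Nat.mul_le_mul_right _ ha

theorem attempt_spec {σ : Store} {V : Set ℝ} (hσ : Prepared I σ) (hV : BestOf I V σ) :
    Runs I.input (attempt π) σ (timeBound m n)
      (BestOf I (V ∪ {v | ∃ h ≤ m, ∃ Q < (n + 1) ^ m, I.Attains π h Q v})) := by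
  refine Runs.seq ((fillRows_spec (I := I) (π := π) hσ.size).mono ?_) fun τ₁ hF₁ hR => ?_
  · have := mul_le_timeBound (m := m) (n := n) (a := 1) (Nat.succ_le_of_lt (by positivity))
    omega
  have hNat₁ : ∀ a, a ≠ 20 → τ₁.nat a = σ.nat a := fun a ha => hF₁.nat a (writesNat_fillRows ha)
  have hReal₁ : ∀ a, a ≠ 1 → τ₁.real a = σ.real a := fun a ha => hF₁.real a (writesReal_fillRows ha)
  have hσ₁ : Prepared I τ₁ := hσ.congr (hNat₁ 0 (by decide)) (hNat₁ 3 (by decide))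
    (hNat₁ 11 (by decide))
  have hV₁ : BestOf I V τ₁ := hV.congr (hNat₁ 1 (by decide)) (hNat₁ 2 (by decide))
    (hReal₁ 0 (by decide)) (hReal₁ 6 (by decide))
  refine Runs.seq ((costs_spec hσ₁.size hR).mono ?_) fun τ₂ hF₂ hC => ?_
  · refine mul_le_timeBound ?_
    calc (m + 1) * (2 * m + 2) = (2 * m + 2) * 1 * (m + 1) := by ring
      _ ≤ _ := by gcongr <;> omega
  have hσ₂ : Prepared I τ₂ := hσ₁.congr (hF₂.nat 0 rfl) (hF₂.nat 3 rfl) (hF₂.nat 11 rfl)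
  have hV₂ : BestOf I V τ₂ := hV₁.congr (hF₂.nat 1 rfl) (hF₂.nat 2 rfl) (hF₂.real 0 rfl)
    (hF₂.real 6 rfl)
  refine Runs.seq ((tableBase_spec hσ₂.weights).mono ?_) fun τ₃ hF₃ hb => ?_
  · refine (Nat.le_mul_of_pos_right _ (Nat.succ_pos n)).trans (mul_le_timeBound ?_)
    exact Nat.mul_le_mul_right _ (Nat.le_mul_of_pos_left _ (by omega))
  have hσ₃ : Prepared I τ₃ := hσ₂.congr (hF₃.nat 0 rfl) (hF₃.nat 3 rfl) (hF₃.nat 11 rfl)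
  have hV₃ : BestOf I V τ₃ := hV₂.congr (hF₃.nat 1 rfl) (hF₃.nat 2 rfl) (hF₃.real 0 rfl)
    (hF₃.real 6 rfl)
  refine Runs.seq ((tableStep_spec (C := I.rowCost π) hσ₃.size hσ₃.weights hσ₃.weight
    (by rw [hF₃.real 2 rfl]; exact hC) hb.1 hb.2).mono le_rfl) fun τ₄ hF₄ hD => ?_
  have hV₄ : BestOf I V τ₄ := hV₃.congr (hF₄.nat 1 rfl) (hF₄.nat 2 rfl) (hF₄.real 0 rfl)
    (hF₄.real 6 rfl)
  refine (scan_spec ⟨hσ₃.congr (hF₄.nat 0 rfl) (hF₄.nat 3 rfl) (hF₄.nat 11 rfl), ?_, hD⟩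
    hV₄).mono ?_
  · rw [hF₄.real 1 rfl, hF₃.real 1 rfl, hF₂.real 1 rfl]
    exact hR
  · calc (m + 1) * (n + 1) * ((n + 1) ^ m + 1) * (m + 2)
        = (m + 1) * ((n + 1) ^ m + 1) * (m + 2) * (n + 1) := by ring
      _ ≤ timeBound m n := mul_le_timeBound <| Nat.mul_le_mul_right _ <|
          Nat.mul_le_mul_right _ (by omega)

theorem writesNat_attempt {a : ℕ} (h20 : a ≠ 20) (h : (costs m).writesNat a = false)
    (h' : (tableBase m).writesNat a = false) (h'' : (tableStep m).writesNat a = false)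
    (h''' : (scan m).writesNat a = false) : (attempt π).writesNat a = false := by
  simp [attempt, writesNat, writesNat_fillRows h20, h, h', h'', h''']

/-- The program contains a separate copy of `attempt` for each pattern. Their number depends on `m`
only and enters the weight, not the factor `timeBound m n`. -/
theorem solver_spec (I : UniformInstance m n) :
    Runs I.input (solver m) I.initial (timeBound m n)
      (BestOf I {v | ∃ π, ∃ h ≤ m, ∃ Q < (n + 1) ^ m, I.Attains π h Q v}) := by
  refine Runs.seq ((powers_spec (n := n) (m := m) (by simp [UniformInstance.initial])
    (by simp [UniformInstance.initial])).mono ?_) fun σ hF hσ => ?_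
  · rw [mul_comm]
    refine mul_le_timeBound ?_
    calc m + 1 = 1 * 1 * (m + 1) := by ring
      _ ≤ _ := by gcongr <;> omega
  have hP : Prepared I σ := ⟨by rw [hF.nat 0 rfl]; simp [UniformInstance.initial],
    by rw [hF.nat 0 rfl]; simp [UniformInstance.initial], hσ.1, hσ.2⟩
  refine (Runs.seqList attempt (fun S τ => BestOf I
    {v | ∃ π ∈ S, ∃ h ≤ m, ∃ Q < (n + 1) ^ m, I.Attains π h Q v} τ)
    (Nat.succ_le_of_lt (by unfold timeBound; positivity)) _ (fun S π _ τ hFτ hτ => ?_) ?_).imp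
    fun τ _ hτ => hτ.mono ?_
  · have hw : ∀ a, a ≠ 20 → (costs m).writesNat a = false → (tableBase m).writesNat a = false →
        (tableStep m).writesNat a = false → (scan m).writesNat a = false →
        τ.nat a = σ.nat a := fun a h0 h1 h2 h3 h4 => hFτ.nat a (writesNat_seqList fun P hP => by
      obtain ⟨π', -, rfl⟩ := List.mem_map.1 hP
      exact writesNat_attempt h0 h1 h2 h3 h4)
    refine (attempt_spec (π := π) (hP.congr (hw 0 (by decide) rfl rfl rfl rfl)
      (hw 3 (by decide) rfl rfl rfl rfl) (hw 11 (by decide) rfl rfl rfl rfl)) hτ).imp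
      fun ρ _ hρ => hρ.mono ?_
    rintro v ⟨π', rfl | hπ', hv⟩
    exacts [Or.inr hv, Or.inl ⟨π', hπ', hv⟩]
  · refine ⟨Or.inl ?_, by simp⟩
    rw [hF.nat 1 rfl]
    simp [UniformInstance.initial]
  · rintro v ⟨π, hv⟩
    exact ⟨π, by simp, hv⟩

end

/-! ### Comparison of the running time with the binomial bound -/

/-- For `n < m` the binomial coefficient vanishes, and the left side is bounded in terms of `m`;
this is what the summand `1` is for. For `n ≥ m` the descending factorial `m! * n.choose m` is at
least `(n + 1 - m) ^ m`, which is comparable to `(n + 1) ^ m`. -/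
theorem succ_pow_succ_le (m n : ℕ) :
    (n + 1) ^ (m + 1) ≤ ((m + 1) ^ (m + 1) + 2 * (m + 1) ^ m * m.factorial) *
      (n.choose m * n ^ 3 + 1) := by
  rcases lt_or_ge n m with h | h
  · calc (n + 1) ^ (m + 1) ≤ (m + 1) ^ (m + 1) := Nat.pow_le_pow_left (by omega) _
      _ ≤ (m + 1) ^ (m + 1) + 2 * (m + 1) ^ m * m.factorial := Nat.le_add_right _ _
      _ ≤ _ := Nat.le_mul_of_pos_right _ (Nat.succ_pos _)
  rcases Nat.eq_zero_or_pos n with rfl | hn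
  · obtain rfl : m = 0 := by omega
    simp
  have h1 : n + 1 ≤ (m + 1) * (n + 1 - m) := by
    obtain ⟨k, rfl⟩ := Nat.exists_eq_add_of_le h
    rw [show m + k + 1 - m = k + 1 by omega]
    nlinarith [Nat.zero_le (m * k)]
  have h2 : (n + 1) ^ m ≤ (m + 1) ^ m * (m.factorial * n.choose m) := by
    calc (n + 1) ^ m ≤ ((m + 1) * (n + 1 - m)) ^ m := Nat.pow_le_pow_left h1 _
      _ = (m + 1) ^ m * (n + 1 - m) ^ m := mul_pow _ _ _
      _ ≤ _ := Nat.mul_le_mul_left _ ((Nat.pow_sub_le_descFactorial n m).trans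
          (Nat.descFactorial_eq_factorial_mul_choose n m).le)
  have h3 : n + 1 ≤ 2 * n ^ 3 := by
    have : n ≤ n ^ 3 := Nat.le_self_pow (by norm_num) n
    omega
  calc (n + 1) ^ (m + 1) = (n + 1) ^ m * (n + 1) := pow_succ _ _
    _ ≤ (m + 1) ^ m * (m.factorial * n.choose m) * (2 * n ^ 3) := Nat.mul_le_mul h2 h3
    _ = 2 * (m + 1) ^ m * m.factorial * (n.choose m * n ^ 3) := by ring
    _ ≤ _ := Nat.mul_le_mul (Nat.le_add_left _ _) (Nat.le_succ _)

theorem timeBound_le (m n : ℕ) : timeBound m n ≤ 2 * (2 * m + 2) * (m + 2) * (n + 1) ^ (m + 1) := by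
  have : (n + 1) ^ m + 1 ≤ 2 * (n + 1) ^ m := by
    have := Nat.one_le_pow m (n + 1) (by omega)
    omega
  calc timeBound m n ≤ (2 * m + 2) * (2 * (n + 1) ^ m) * (m + 2) * (n + 1) := by
        unfold timeBound; gcongr
    _ = _ := by ring

end CKFL

theorem mainTheorem2 (m : ℕ) :
    ∃ (P : CKFL.Program) (K : ℕ), ∀ (n : ℕ) (I : CKFL.UniformInstance m n),
      ∃ t : ℕ, t ≤ K * (n.choose m * n ^ 3 + 1) ∧ I.SolvedBy P t := by
  refine ⟨CKFL.Program.solver m, (CKFL.Program.solver m).weight * (2 * (2 * m + 2) * (m + 2) *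
    ((m + 1) ^ (m + 1) + 2 * (m + 1) ^ m * m.factorial)), fun n I => ?_⟩
  obtain ⟨t, τ, hE, ht, hbest, hall⟩ := CKFL.solver_spec I
  refine ⟨t, ht.trans ?_, τ, hE, ?_, fun hno => ?_⟩
  · rw [mul_assoc, mul_assoc _ _ (n.choose m * n ^ 3 + 1)]
    exact Nat.mul_le_mul_left _ ((CKFL.timeBound_le m n).trans
      (Nat.mul_le_mul_left _ (CKFL.succ_pow_succ_le m n)))
  -- Every feasible solution is dominated by an attained value, and the output is at most each
  -- attained value. So a feasible instance sets the flag and makes the output optimal.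
  · have key : ∀ x y, I.IsFeasible x y → τ.nat 1 0 0 = 1 ∧ τ.real 6 0 0 ≤ I.totalCost x y :=
      fun x y hxy => by
        obtain ⟨π, h, Q, v, hh, hQ, hv, hle⟩ := CKFL.UniformInstance.exists_attains hxy
        obtain ⟨h1, h2⟩ := hall v ⟨π, h, hh, Q, hQ, hv⟩
        exact ⟨h1, h2.trans hle⟩
    rintro ⟨x, y, hxy⟩
    have h1 := (key x y hxy).1
    rcases hbest with h0 | ⟨-, hf, hc⟩
    · omega
    · exact ⟨h1, hf, fun x' y' h' => hc.trans_le (key x' y' h').2⟩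
  · rcases hbest with h0 | ⟨-, hf, -⟩
    · exact h0
    · exact absurd ⟨_, _, hf⟩ hno
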